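/- **Setting.** Let $\mathbb F_q$ be a finite field, $A=\mathbb F_q[t]$, $K$ a field with a ring morphism $i:A\to K$, and $K\{\tau\}$ the ring of polynomials in $\tau:x\mapsto x^q$ over $K$ (multiplication is composition). Let $\mathbb C_\infty$ be a complete, algebraically closed, non-archimedean valued field containing $K$ whose absolute value satisfies $|i(a)|=q^{\deg a}$ for all $0\ne a\in A$ (so $i$ is injective); for example, the completion of an algebraic closure of the completion of $K$ at an extension of $v_\infty$ to $K$. Let $K^{\mathrm{sep}}$ be the separable closure of $K$ in $\mathbb C_\infty$. Let $\phi:A\to K\{\tau\}$ be a Drinfeld module (of generic characteristic): a ring morphism such that the coefficient of $\tau^0$ in $\phi_a$ is $i(a)$ for all $a$, and $\phi_a\neq i(a)\tau^0$ for some $a$. Assume $\operatorname{End}(\phi)=A$, i.e. every $f\in K^{\mathrm{sep}}\{\tau\}$ commuting with all $\phi_a$ is equal to some $\phi_a$. **Definitions.** $A$ acts on $\mathbb G_a^g$ diagonally through $\phi$; a point is torsion if it is killed by some $\phi_a$ with $a\ne0$. Subvarieties are closed and possibly reducible. An algebraic $\phi$-submodule of $\mathbb G_a^g$ is a $K^{\mathrm{sep}}$-subvariety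 of $\mathbb G_a^g$ invariant under all $\phi_a$. A torsion subvariety is a translate of an irreducible algebraic $\phi$-submodule by a torsion point. A maximal torsion subvariety of $X$ is a torsion subvariety contained in $X$ that is maximal for inclusion among these. A sequence $(x_k)$ of points of $\mathbb G_a^g$ is strict if each torsion subvariety of $\mathbb G_a^g$ other than $\mathbb G_a^g$ itself contains $x_k$ for only finitely many $k$. Let $T$ be the closure in $\mathbb C_\infty$ of the set $\phi_{\mathrm{tor}}$ of torsion points of $\mathbb G_a$ (a compact group), $\nu$ its Haar measure of total mass $1$, and $\nu^{(g)}$ the product measure on $T^g$. For a torsion point $x\in\mathbb G_a^g(K^{\mathrm{sep}})$ with orbit $O(x)\subset T^g$ under $\operatorname{Gal}(K^{\mathrm{sep}}/K)$, put $\overline\delta_x=\frac1{\#O(x)}\sum_{y\in O(x)}\delta_y$, a probability measure on $T^g$. **Theorem.** Let $N\ge0$. Assume that for every $1\le g\le N$ the equidistribution conjecture holds for $\phi$ on $\mathbb G_a^g$: for every strict sequence $(x_k)$ of torsion points of $\mathbb G_a^g$, the measures $\overline\delta_{x_k}$ converge weakly to $\nu^{(g)}$ on $T^g$. Let $Y$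 be an algebraic $\phi$-submodule of $\mathbb G_a^N$ and let $X$ be a $K^{\mathrm{sep}}$-subvariety of $Y$. Then $X$ has at most finitely many maximal torsion subvarieties. -/

import Mathlib

open Polynomial MeasureTheory Filter Topology
open scoped ENNReal BoundedContinuousFunction

noncomputable section

/-- A polynomial in the operator `τ : x ↦ x ^ q`, written as the polynomial function it induces:
`∑ cᵢ τ ^ i` is the polynomial `∑ cᵢ X ^ (q ^ i)`.  Addition in `R{τ}` is addition of polynomials,
multiplication in `R{τ}` is composition of polynomials, and `τ ^ 0` is `X`. -/
def IsTauPolynomial {R : Type*} [CommRing R] (q : ℕ) (f : R[X]) : Prop :=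
  ∀ n ∈ f.support, ∃ i : ℕ, n = q ^ i

/-- A Drinfeld module `φ : A → K{τ}`, where `A = 𝔽[X]` for a finite field `𝔽` with `q` elements and
the fixed morphism `i : A → K` is `algebraMap 𝔽[X] K`.  The fields say that `φ` is a ring morphism
from `A` to `K{τ}`, that the coefficient of `τ ^ 0` in `φ_a` is `i a`, and that
`φ_a ≠ i(a) τ ^ 0` for some `a`. -/
structure DrinfeldModule (𝔽 K : Type*) [Field 𝔽] [Fintype 𝔽] [Field K] [Algebra 𝔽[X] K] where
  toFun : 𝔽[X] → K[X]
  isTauPolynomial' : ∀ a, IsTauPolynomial (Fintype.card 𝔽) (toFun a)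
  map_add' : ∀ a b, toFun (a + b) = toFun a + toFun b
  map_one' : toFun 1 = X
  map_mul' : ∀ a b, toFun (a * b) = (toFun a).comp (toFun b)
  coeff_one' : ∀ a, (toFun a).coeff 1 = algebraMap 𝔽[X] K a
  exists_ne' : ∃ a, toFun a ≠ C (algebraMap 𝔽[X] K a) * X

/-- The absolute value of `L` extends the absolute value `|a| = q ^ deg a` of `A = 𝔽[X]`
(that is, `|x| = q ^ (-v_∞(x))` on `Frac A`), along `A → K → L`. -/
class ExtendsDegreeNorm (𝔽 K L : Type*) [Field 𝔽] [Fintype 𝔽] [Field K] [Algebra 𝔽[X] K]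
    [NormedField L] [Algebra K L] : Prop where
  norm_algebraMap : ∀ a : 𝔽[X], a ≠ 0 →
    ‖algebraMap K L (algebraMap 𝔽[X] K a)‖ = (Fintype.card 𝔽 : ℝ) ^ a.natDegree

/-- Weak convergence of a sequence of (probability) measures: convergence of the integrals of all
bounded continuous real functions. -/
def WeaklyConverges {S : Type*} [TopologicalSpace S] [MeasurableSpace S]
    (m : ℕ → Measure S) (m₀ : Measure S) : Prop :=
  ∀ f : S →ᵇ ℝ, Tendsto (fun k => ∫ s, f s ∂(m k)) atTop (𝓝 (∫ s, f s ∂m₀))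

section Subvarieties

variable (K : Type*) {L : Type*} [Field K] [Field L] [Algebra K L] {g : ℕ}

/-- A (closed, possibly reducible) `K^sep`-subvariety of `𝔾_a^g`, given by its set of points in the
algebraically closed field `L`: the common zeros of an ideal of polynomials with coefficients in
the separable closure of `K` in `L`. -/
def IsSepSubvariety (Z : Set (Fin g → L)) : Prop :=
  ∃ I : Ideal (MvPolynomial (Fin g) (separableClosure K L)), Z = MvPolynomial.zeroLocus L I

/-- Irreducible closed `K^sep`-subvarieties. -/
def IsIrreducibleSepSubvariety (Z : Set (Fin g → L)) : Prop :=
  IsSepSubvariety K Z ∧ Z.Nonempty ∧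
    ∀ Z₁ Z₂ : Set (Fin g → L), IsSepSubvariety K Z₁ → IsSepSubvariety K Z₂ →
      Z ⊆ Z₁ ∪ Z₂ → Z ⊆ Z₁ ∨ Z ⊆ Z₂

end Subvarieties

namespace DrinfeldModule

variable {𝔽 K L : Type*} [Field 𝔽] [Fintype 𝔽] [Field K] [Algebra 𝔽[X] K]

section Algebraic

variable [Field L] [Algebra K L]

/-- The action `a * x = φ_a(x)` of `A` on `𝔾_a(L)`. -/
def act (φ : DrinfeldModule 𝔽 K) (a : 𝔽[X]) (x : L) : L := aeval x (φ.toFun a)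

/-- The diagonal action of `A` on `𝔾_a^g(L)`. -/
def diagAct (φ : DrinfeldModule 𝔽 K) {g : ℕ} (a : 𝔽[X]) (x : Fin g → L) : Fin g → L :=
  fun i => φ.act a (x i)

/-- Torsion points of `𝔾_a^g`. -/
def IsTorsionPoint (φ : DrinfeldModule 𝔽 K) {g : ℕ} (x : Fin g → L) : Prop :=
  ∃ a : 𝔽[X], a ≠ 0 ∧ ∀ i, φ.act a (x i) = 0

/-- An algebraic `φ`-submodule of `𝔾_a^g`: a `K^sep`-subvariety invariant under the action
of `φ`. -/
def IsAlgSubmodule (φ : DrinfeldModule 𝔽 K) {g : ℕ} (Y : Set (Fin g → L)) : Prop :=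
  IsSepSubvariety K Y ∧ ∀ a : 𝔽[X], ∀ y ∈ Y, φ.diagAct a y ∈ Y

/-- A torsion subvariety of `𝔾_a^g`: a translate of an irreducible algebraic `φ`-submodule by a
torsion point. -/
def IsTorsionSubvariety (φ : DrinfeldModule 𝔽 K) {g : ℕ} (Z : Set (Fin g → L)) : Prop :=
  ∃ (α : Fin g → L) (W : Set (Fin g → L)), φ.IsTorsionPoint α ∧ φ.IsAlgSubmodule W ∧
    IsIrreducibleSepSubvariety K W ∧ Z = (fun w => α + w) '' W

/-- A sequence of points of `𝔾_a^g` is strict if any proper torsion subvariety contains its `k`-th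
term for only finitely many `k`. -/
def IsStrict (φ : DrinfeldModule 𝔽 K) {g : ℕ} (x : ℕ → Fin g → L) : Prop :=
  ∀ Z : Set (Fin g → L), φ.IsTorsionSubvariety Z → Z ≠ Set.univ → {k | x k ∈ Z}.Finite

/-- `Z` is a maximal torsion subvariety of `X`: a torsion subvariety contained in `X`, maximal with
respect to inclusion among these. -/
def IsMaximalTorsionSubvariety (φ : DrinfeldModule 𝔽 K) {g : ℕ} (X Z : Set (Fin g → L)) : Prop :=
  Maximal (fun Z' => φ.IsTorsionSubvariety Z' ∧ Z' ⊆ X) Z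

variable (L) in
/-- `End(φ) = A`: every `f ∈ K^sep{τ}` commuting with all `φ_a` is itself some `φ_a`. -/
def EndEqBase (φ : DrinfeldModule 𝔽 K) : Prop :=
  ∀ f : (separableClosure K L)[X], IsTauPolynomial (Fintype.card 𝔽) f →
    (∀ a : 𝔽[X], f.comp ((φ.toFun a).map (algebraMap K (separableClosure K L))) =
      ((φ.toFun a).map (algebraMap K (separableClosure K L))).comp f) →
    ∃ a : 𝔽[X], f = (φ.toFun a).map (algebraMap K (separableClosure K L))

theorem toFun_zero (φ : DrinfeldModule 𝔽 K) : φ.toFun 0 = 0 := by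
  simpa using φ.map_add' 0 0

theorem act_mul (φ : DrinfeldModule 𝔽 K) (a b : 𝔽[X]) (x : L) :
    φ.act (a * b) x = φ.act a (φ.act b x) := by
  simp [act, φ.map_mul', aeval_comp]

theorem act_add_right (φ : DrinfeldModule 𝔽 K) (a : 𝔽[X]) (x y : L) :
    φ.act a (x + y) = φ.act a x + φ.act a y := by
  let f : 𝔽 →+* L := (algebraMap K L).comp ((algebraMap 𝔽[X] K).comp C)
  obtain ⟨p, hp⟩ := CharP.exists 𝔽
  obtain ⟨n, hprime, hcard⟩ := FiniteField.card 𝔽 p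
  have : Fact p.Prime := ⟨hprime⟩
  have : CharP L p := (f.charP_iff f.injective p).1 hp
  simp only [act, aeval_def, eval₂_eq_sum, Polynomial.sum]
  rw [← Finset.sum_add_distrib]
  refine Finset.sum_congr rfl fun m hm => ?_
  obtain ⟨i, rfl⟩ := φ.isTauPolynomial' a m hm
  rw [hcard, ← pow_mul, add_pow_char_pow, mul_add]

theorem act_zero_right (φ : DrinfeldModule 𝔽 K) (a : 𝔽[X]) : φ.act a (0 : L) = 0 := by
  simpa using φ.act_add_right a (0 : L) 0

theorem act_neg_right (φ : DrinfeldModule 𝔽 K) (a : 𝔽[X]) (x : L) :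
    φ.act a (-x) = - φ.act a x := by
  rw [eq_neg_iff_add_eq_zero, ← act_add_right, neg_add_cancel, act_zero_right]

variable (L) in
/-- The torsion submodule `φ_tor` (its elements are algebraic over `K` as soon as `i` is
injective). -/
def torsion (φ : DrinfeldModule 𝔽 K) : AddSubgroup L where
  carrier := {x | ∃ a : 𝔽[X], a ≠ 0 ∧ φ.act a x = 0}
  zero_mem' := ⟨1, one_ne_zero, φ.act_zero_right 1⟩
  add_mem' := by
    rintro x y ⟨a, ha, hax⟩ ⟨b, hb, hby⟩
    refine ⟨a * b, mul_ne_zero ha hb, ?_⟩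
    rw [act_add_right, act_mul φ a b y, hby, mul_comm, act_mul, hax, act_zero_right,
      act_zero_right, add_zero]
  neg_mem' := by
    rintro x ⟨a, ha, hax⟩
    exact ⟨a, ha, by rw [act_neg_right, hax, neg_zero]⟩

end Algebraic

section Analytic

variable [NormedField L] [Algebra K L]

variable (L) in
/-- `T`, the closure of `φ_tor` in `L`. -/
def torsionClosure (φ : DrinfeldModule 𝔽 K) : AddSubgroup L := (φ.torsion L).topologicalClosure

/-! ### Compactness of `T`

This is what makes the normalized Haar measure of `T` available. -/

theorem norm_coeff_lt [IsUltrametricDist L] {ρ : ℝ} (hρ : 0 ≤ ρ) (s : Multiset L)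
    (hs : ∀ w ∈ s, ρ < ‖w‖) :
    ‖((s.map fun w => X - C w).prod).coeff 1‖ * ρ < ‖((s.map fun w => X - C w).prod).coeff 0‖ := by
  induction s using Multiset.induction with
  | empty => simp [coeff_one]
  | cons w s ih =>
    have ih := ih fun v hv => hs v (Multiset.mem_cons_of_mem hv)
    have hw := hs w (Multiset.mem_cons_self w s)
    rw [Multiset.map_cons, Multiset.prod_cons]
    set f := (s.map fun w => X - C w).prod
    have h0 : ((X - C w) * f).coeff 0 = -(w * f.coeff 0) := by simp [sub_mul]
    have h1 : ((X - C w) * f).coeff 1 = f.coeff 0 - w * f.coeff 1 := by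
      simp [sub_mul, coeff_X_mul]
    have hf : 0 < ‖f.coeff 0‖ := lt_of_le_of_lt (by positivity) ih
    have hw0 : 0 < ‖w‖ := lt_of_le_of_lt hρ hw
    have hmax : ‖f.coeff 0 - w * f.coeff 1‖ ≤ max ‖f.coeff 0‖ ‖w * f.coeff 1‖ := by
      simpa [sub_eq_add_neg] using IsUltrametricDist.norm_add_le_max (f.coeff 0) (-(w * f.coeff 1))
    rw [h0, h1, norm_neg, norm_mul]
    rcases le_max_iff.1 hmax with h | h
    · calc _ ≤ ‖f.coeff 0‖ * ρ := by gcongr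
        _ < ‖w‖ * ‖f.coeff 0‖ := by nlinarith
    · rw [norm_mul] at h
      calc _ ≤ ‖w‖ * ‖f.coeff 1‖ * ρ := by gcongr
        _ = ‖w‖ * (‖f.coeff 1‖ * ρ) := by ring
        _ < ‖w‖ * ‖f.coeff 0‖ := by gcongr

variable [ExtendsDegreeNorm 𝔽 K L]

theorem exists_act_eq [IsUltrametricDist L] [IsAlgClosed L] (φ : DrinfeldModule 𝔽 K) {a : 𝔽[X]}
    (ha : a ≠ 0) (y : L) :
    ∃ w : L, φ.act a w = y ∧ ‖w‖ ≤ ‖y‖ / (Fintype.card 𝔽 : ℝ) ^ a.natDegree := by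
  have hq : 0 < (Fintype.card 𝔽 : ℝ) ^ a.natDegree := by
    have : 0 < Fintype.card 𝔽 := Fintype.card_pos
    positivity
  by_contra! hcon
  set P : L[X] := (φ.toFun a).map (algebraMap K L) - C y with hP
  have hP0 : P.coeff 0 = -y := by
    have : φ.act a (0 : L) = 0 := φ.act_zero_right a
    rw [act, aeval_def, eval₂_at_zero] at this
    simp [hP, this]
  have hP1 : ‖P.coeff 1‖ = (Fintype.card 𝔽 : ℝ) ^ a.natDegree := by
    rw [← ExtendsDegreeNorm.norm_algebraMap (K := K) (L := L) a ha, ← φ.coeff_one' a]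
    simp [hP]
  have hroot : ∀ w ∈ P.roots, ‖y‖ / (Fintype.card 𝔽 : ℝ) ^ a.natDegree < ‖w‖ := by
    intro w hw
    apply hcon
    have := (mem_roots'.1 hw).2
    rw [IsRoot.def, hP, eval_sub, eval_C, eval_map, sub_eq_zero] at this
    rw [act, aeval_def, this]
  have key := norm_coeff_lt (by positivity) P.roots hroot
  have hsplit : P = C P.leadingCoeff * (P.roots.map fun w => X - C w).prod :=
    (IsAlgClosed.splits P).eq_prod_roots
  set f := (P.roots.map fun w => X - C w).prod
  have e0 : ‖P.leadingCoeff‖ * ‖f.coeff 0‖ = ‖y‖ := by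
    rw [← norm_mul, ← coeff_C_mul, ← hsplit, hP0, norm_neg]
  have e1 : ‖P.leadingCoeff‖ * ‖f.coeff 1‖ = (Fintype.card 𝔽 : ℝ) ^ a.natDegree := by
    rw [← norm_mul, ← coeff_C_mul, ← hsplit, hP1]
  have hlc : 0 < ‖P.leadingCoeff‖ := by
    rcases (norm_nonneg P.leadingCoeff).eq_or_lt with h | h
    · rw [← h, zero_mul] at e1
      exact absurd e1 hq.ne
    · exact h
  have := mul_lt_mul_of_pos_left key hlc
  rw [← mul_assoc, e0, e1, mul_div_cancel₀ _ hq.ne'] at this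
  exact lt_irrefl _ this

/-- A non-constant `a` for which `φ_a` has degree at least two. -/
theorem exists_natDegree (φ : DrinfeldModule 𝔽 K) :
    ∃ a : 𝔽[X], 0 < a.natDegree ∧ 1 < (φ.toFun a).natDegree := by
  have hcoeff : ∀ a, (φ.toFun a).coeff 0 = 0 := fun a => by
    by_contra h
    obtain ⟨i, hi⟩ := φ.isTauPolynomial' a 0 (mem_support_iff.2 h)
    exact (pow_pos (Fintype.card_pos (α := 𝔽)) i).ne hi
  have hdeg : ∀ a, (φ.toFun a).natDegree ≤ 1 → φ.toFun a = C (algebraMap 𝔽[X] K a) * X := by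
    intro a h
    rw [eq_X_add_C_of_natDegree_le_one h, hcoeff a, φ.coeff_one' a]
    simp
  obtain ⟨a, ha⟩ := φ.exists_ne'
  have h1 : 1 < (φ.toFun a).natDegree := by
    by_contra! h
    exact ha (hdeg a h)
  refine ⟨a, ?_, h1⟩
  by_contra! h0
  obtain ⟨c, rfl⟩ := natDegree_eq_zero.1 (Nat.le_zero.1 h0)
  have hc : c ≠ 0 := by
    rintro rfl
    simp [φ.toFun_zero] at h1
  have := φ.map_mul' (C c) (C c⁻¹)
  rw [← C_mul, mul_inv_cancel₀ hc, C_1, φ.map_one'] at this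
  have := congrArg natDegree this
  rw [natDegree_X, natDegree_comp] at this
  have := Nat.eq_one_of_mul_eq_one_right this.symm
  omega

theorem exists_norm_le_of_mem_torsion (φ : DrinfeldModule 𝔽 K) :
    ∃ R : ℝ, ∀ x ∈ φ.torsion L, ‖x‖ ≤ R := by
  classical
  obtain ⟨a, -, ha⟩ := φ.exists_natDegree
  set P : L[X] := (φ.toFun a).map (algebraMap K L) with hP
  have hPdeg : 1 < P.natDegree := by rwa [hP, natDegree_map]
  have hP0 : P.coeff 0 = 0 := by
    have : φ.act a (0 : L) = 0 := φ.act_zero_right a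
    rw [act, aeval_def, eval₂_at_zero] at this
    simp [hP, this]
  have hPX : P.divX * X = P := by simpa [hP0] using P.divX_mul_X_add
  have hQ : 0 < P.divX.degree := by
    rw [← natDegree_pos_iff_degree_pos, natDegree_divX_eq_natDegree_tsub_one]
    omega
  have ht : Tendsto (fun x : L => ‖P.divX.eval x‖) (comap norm atTop) atTop :=
    P.divX.tendsto_norm_atTop hQ (z := fun x => x) tendsto_comap
  have hev := ht.eventually_gt_atTop 1
  rw [eventually_comap] at hev
  obtain ⟨R, hR⟩ := eventually_atTop.1 hev
  refine ⟨max R 0, ?_⟩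
  rintro x ⟨b, hb, hbx⟩
  by_contra! hx
  set B : L[X] := (φ.toFun b).map (algebraMap K L) with hB
  have hB0 : B ≠ 0 := by
    intro h
    have h1 : B.coeff 1 = algebraMap K L (algebraMap 𝔽[X] K b) := by simp [hB, φ.coeff_one' b]
    have h2 := ExtendsDegreeNorm.norm_algebraMap (K := K) (L := L) b hb
    rw [← h1, h] at h2
    have : 0 < (Fintype.card 𝔽 : ℝ) ^ b.natDegree := by
      have : 0 < Fintype.card 𝔽 := Fintype.card_pos
      positivity
    simp at h2
    exact this.ne h2
  have hmem : ∀ z : L, z ∈ B.roots.toFinset ↔ φ.act b z = 0 := fun z => by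
    rw [Multiset.mem_toFinset, mem_roots hB0, IsRoot.def, hB, eval_map, act, aeval_def]
  obtain ⟨z, hz, hmax⟩ := B.roots.toFinset.exists_max_image (fun z => ‖z‖) ⟨x, (hmem x).2 hbx⟩
  have hzx : ‖x‖ ≤ ‖z‖ := hmax x ((hmem x).2 hbx)
  have hz' : φ.act b (φ.act a z) = 0 := by
    rw [← act_mul, mul_comm, act_mul, (hmem z).1 hz, act_zero_right]
  have h1 := hmax _ ((hmem _).2 hz')
  have h2 : φ.act a z = P.divX.eval z * z := by
    have h := congrArg (eval z) hPX
    rw [eval_mul, eval_X] at h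
    rw [act, aeval_def, ← eval_map, ← hP, h]
  have hzR : max R 0 < ‖z‖ := hx.trans_le hzx
  have h3 := hR ‖z‖ ((le_max_left _ _).trans hzR.le) z rfl
  have hz0 : 0 < ‖z‖ := (le_max_right _ _).trans_lt hzR
  rw [h2, norm_mul] at h1
  nlinarith

theorem totallyBounded_torsion [IsUltrametricDist L] [IsAlgClosed L] (φ : DrinfeldModule 𝔽 K) :
    TotallyBounded (φ.torsion L : Set L) := by
  classical
  obtain ⟨R, hR⟩ := φ.exists_norm_le_of_mem_torsion (L := L)
  obtain ⟨a, ha, -⟩ := φ.exists_natDegree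
  have ha0 : a ≠ 0 := by
    rintro rfl
    simp at ha
  rw [Metric.totallyBounded_iff]
  intro ε hε
  have hq : 1 < (Fintype.card 𝔽 : ℝ) := by exact_mod_cast Fintype.one_lt_card
  obtain ⟨n, hn⟩ := pow_unbounded_of_one_lt (R / ε) hq
  have hb0 : a ^ n ≠ 0 := pow_ne_zero n ha0
  set B : L[X] := (φ.toFun (a ^ n)).map (algebraMap K L) with hB
  have hqn : (0 : ℝ) < (Fintype.card 𝔽 : ℝ) ^ (a ^ n).natDegree := by positivity
  have hB0 : B ≠ 0 := by
    intro h
    have h1 : B.coeff 1 = algebraMap K L (algebraMap 𝔽[X] K (a ^ n)) := by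
      simp [hB, φ.coeff_one' (a ^ n)]
    have h2 := ExtendsDegreeNorm.norm_algebraMap (K := K) (L := L) (a ^ n) hb0
    rw [← h1, h, coeff_zero, norm_zero] at h2
    exact hqn.ne h2
  refine ⟨B.roots.toFinset, Finset.finite_toSet _, fun x hx => ?_⟩
  obtain ⟨c, hc, hcx⟩ := hx
  have hy : φ.act (a ^ n) x ∈ φ.torsion L :=
    ⟨c, hc, by rw [← act_mul, mul_comm, act_mul, hcx, act_zero_right]⟩
  obtain ⟨w, hw, hwn⟩ := φ.exists_act_eq hb0 (φ.act (a ^ n) x)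
  have hroot : x - w ∈ B.roots.toFinset := by
    rw [Multiset.mem_toFinset, mem_roots hB0, IsRoot.def, hB, eval_map, ← aeval_def]
    change φ.act (a ^ n) (x - w) = 0
    rw [sub_eq_add_neg, act_add_right, act_neg_right, hw, add_neg_cancel]
  refine Set.mem_iUnion₂.2 ⟨x - w, hroot, ?_⟩
  rw [Metric.mem_ball, dist_eq_norm, sub_sub_cancel]
  refine hwn.trans_lt ((div_lt_iff₀ hqn).2 ?_)
  have h1 : R < (Fintype.card 𝔽 : ℝ) ^ n * ε := (div_lt_iff₀ hε).1 hn
  have h2 : (Fintype.card 𝔽 : ℝ) ^ n ≤ (Fintype.card 𝔽 : ℝ) ^ (a ^ n).natDegree := by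
    refine pow_le_pow_right₀ hq.le ?_
    rw [natDegree_pow]
    exact Nat.le_mul_of_pos_right n ha
  have h3 := hR _ hy
  nlinarith

instance compactSpace_torsionClosure [IsUltrametricDist L] [CompleteSpace L] [IsAlgClosed L]
    (φ : DrinfeldModule 𝔽 K) : CompactSpace (φ.torsionClosure L) :=
  isCompact_iff_compactSpace.1
    (φ.totallyBounded_torsion.closure.isCompact_of_isClosed isClosed_closure)

variable [IsUltrametricDist L] [CompleteSpace L] [IsAlgClosed L] [MeasurableSpace L] [BorelSpace L]

variable (L) in
/-- `ν`, the Haar measure on the compact group `T` of total mass one. -/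
def haarProb (φ : DrinfeldModule 𝔽 K) : Measure (φ.torsionClosure L) := Measure.addHaarMeasure ⊤

instance isProbabilityMeasure_haarProb (φ : DrinfeldModule 𝔽 K) :
    IsProbabilityMeasure (φ.haarProb L) :=
  ⟨by simpa [haarProb] using
    Measure.addHaarMeasure_self (K₀ := (⊤ : TopologicalSpace.PositiveCompacts (φ.torsionClosure L)))⟩

variable (L) in
/-- `ν^(g)`, the product measure on `T^g`. -/
def haarProbPi (φ : DrinfeldModule 𝔽 K) (g : ℕ) : Measure (Fin g → φ.torsionClosure L) :=
  Measure.pi fun _ => φ.haarProb L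

/-- For a torsion point `x` of `𝔾_a^g` (whose coordinates lie in `K^sep`), the orbit `O(x)` under
the diagonal action of `Gal(K^sep/K)`.  Conjugates of torsion points are torsion points, so the whole
orbit lies in `T^g`, and it is recorded as a subset of `T^g`. -/
def galoisOrbit (φ : DrinfeldModule 𝔽 K) {g : ℕ} (x : Fin g → separableClosure K L) :
    Set (Fin g → φ.torsionClosure L) :=
  {y | ∃ σ : separableClosure K L ≃ₐ[K] separableClosure K L,
    ∀ i, (y i : L) = ((σ (x i) : separableClosure K L) : L)}

/-- The probability measure `(1 / #O(x)) ∑_{y ∈ O(x)} δ_y` on `T^g`, for a torsion point `x`. -/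
def orbitMeasure (φ : DrinfeldModule 𝔽 K) {g : ℕ} (x : Fin g → separableClosure K L) :
    Measure (Fin g → φ.torsionClosure L) :=
  ((φ.galoisOrbit x).ncard : ℝ≥0∞)⁻¹ • ∑ᶠ y ∈ φ.galoisOrbit x, Measure.dirac y

variable (L) in
/-- The equidistribution conjecture for `φ` on `𝔾_a^g`: if `End(φ) = A`, then for every strict
sequence of torsion points of `𝔾_a^g` the Galois orbit measures converge weakly to `ν^(g)` on
`T^g`. -/
def EquidistributionConjecture (φ : DrinfeldModule 𝔽 K) (g : ℕ) : Prop :=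
  φ.EndEqBase L → ∀ x : ℕ → Fin g → separableClosure K L,
    (∀ k, φ.IsTorsionPoint fun i => (x k i : L)) → φ.IsStrict (fun k i => (x k i : L)) →
      WeaklyConverges (fun k => φ.orbitMeasure (x k)) (φ.haarProbPi L g)

end Analytic

end DrinfeldModule

end

/-! The argument is Manin–Mumford by equidistribution. The central statement is
`DrinfeldModule.isTorsionSubvariety_sepZariskiClosure`: an irreducible set `S` of torsion points has
a torsion subvariety as Zariski closure. Granting it, the torsion points of `X` split into finitely
many irreducible sets, whose closures are torsion subvarieties contained in `X`. A torsion
subvariety `Z` of `X` is the closure of its torsion points, so irreducibility puts `Z` inside one of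
these closures, and a maximal `Z` equals it.

The central statement is proved by induction on the dimension. If `S` lies in the kernel of a
nonzero form `∑ φ_{bᵢ}(xᵢ)`, a unimodular change of coordinates over the principal ideal domain `A`
turns the form into `d` times a coordinate; that coordinate takes `d`-torsion values on `S`, hence
is constant on `S`, and can be dropped. If `S` lies in no such kernel, then, the forms being
countable, `S` contains a sequence that meets each kernel only finitely often. It is strict, since
every proper torsion subvariety lies in the kernel of a nonzero form. A nonzero polynomial vanishing
on `S` would yield a nonzero `F` over `K` vanishing on `S`, hence on all the Galois orbits.
Equidistribution gives `∫ min(|F|, 1) = 0` on `T^g`, so `F` vanishes on `T^g`, which contains the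
Zariski dense set of torsion points, a contradiction.

The algebraic input is that a proper irreducible submodule lies in the kernel of a nonzero form
(`DrinfeldModule.exists_linearForm_mem`); this is where `End(φ) = A` enters. Elimination of
variables reduces to one invariant prime `F`. Its pullback by `φ_a` has degree at most `deg F * #ker
φ_a` and is divisible by all translates of `F` under `(ker φ_a)^(n+1)`, so `F` has a large
stabilizer. By Schwartz–Zippel the stabilizer is dense in `F = 0`, which makes `F` additive: `F = ∑
fᵢ(xᵢ)` with `fᵢ ∘ φ_a = h_a ∘ fᵢ`. A separability argument yields `g` with `g ∘ f₀ = φ_b`; then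
every `g ∘ fᵢ` commutes with `φ`, so it is some `φ_{Bᵢ}`. -/

namespace IsTauPolynomial

/-! ### Additive polynomials in one variable -/

section Ring

variable {R : Type*} [CommRing R] {q : ℕ} {f g : R[X]}

theorem of_coeff (h : ∀ n, f.coeff n ≠ 0 → ∃ i : ℕ, n = q ^ i) : IsTauPolynomial q f :=
  fun n hn => h n (mem_support_iff.1 hn)

theorem exists_of_coeff_ne_zero (hf : IsTauPolynomial q f) {n : ℕ} (hn : f.coeff n ≠ 0) :
    ∃ i : ℕ, n = q ^ i :=
  hf n (mem_support_iff.2 hn)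

theorem zero : IsTauPolynomial q (0 : R[X]) := of_coeff fun n hn => absurd (coeff_zero n) hn

theorem add (hf : IsTauPolynomial q f) (hg : IsTauPolynomial q g) : IsTauPolynomial q (f + g) :=
  of_coeff fun n hn => by
    by_cases h : f.coeff n = 0
    · exact hg.exists_of_coeff_ne_zero fun h' => hn (by rw [coeff_add, h, h', add_zero])
    · exact hf.exists_of_coeff_ne_zero h

theorem C_mul (c : R) (hf : IsTauPolynomial q f) : IsTauPolynomial q (C c * f) :=
  of_coeff fun n hn => hf.exists_of_coeff_ne_zero fun h => hn (by rw [coeff_C_mul, h, mul_zero])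

theorem sub (hf : IsTauPolynomial q f) (hg : IsTauPolynomial q g) : IsTauPolynomial q (f - g) := by
  have h : f - g = f + C (-1) * g := by simp [sub_eq_add_neg]
  rw [h]
  exact hf.add (hg.C_mul _)

theorem sum {ι : Type*} (s : Finset ι) (F : ι → R[X]) (h : ∀ i ∈ s, IsTauPolynomial q (F i)) :
    IsTauPolynomial q (∑ i ∈ s, F i) := by
  classical
  induction s using Finset.induction_on with
  | empty => simpa using zero
  | insert a s ha ih =>
    rw [Finset.sum_insert ha]
    exact (h a (Finset.mem_insert_self a s)).add
      (ih fun i hi => h i (Finset.mem_insert_of_mem hi))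

theorem map {S : Type*} [CommRing S] (j : R →+* S) (hf : IsTauPolynomial q f) :
    IsTauPolynomial q (f.map j) :=
  of_coeff fun n hn => hf.exists_of_coeff_ne_zero fun h => hn (by rw [coeff_map, h, map_zero])

theorem of_pow {m : ℕ} (hf : IsTauPolynomial (q ^ m) f) : IsTauPolynomial q f := fun n hn => by
  obtain ⟨i, rfl⟩ := hf n hn
  exact ⟨m * i, (pow_mul q m i).symm⟩

theorem coeff_zero_eq_zero (hq : q ≠ 0) (hf : IsTauPolynomial q f) : f.coeff 0 = 0 := by
  by_contra h
  obtain ⟨i, hi⟩ := hf.exists_of_coeff_ne_zero h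
  exact pow_ne_zero i hq hi.symm

theorem exists_natDegree_eq (hf : IsTauPolynomial q f) (h0 : f ≠ 0) :
    ∃ i : ℕ, f.natDegree = q ^ i :=
  hf.exists_of_coeff_ne_zero (leadingCoeff_ne_zero.2 h0)

end Ring

section CharP

variable {R : Type*} [CommRing R] {p : ℕ} [Fact p.Prime] {f g : R[X]}

theorem aeval_add {S : Type*} [CommRing S] [Algebra R S] [CharP S p] (hf : IsTauPolynomial p f)
    (x y : S) : aeval (x + y) f = aeval x f + aeval y f := by
  simp only [aeval_def, eval₂_eq_sum, Polynomial.sum]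
  rw [← Finset.sum_add_distrib]
  refine Finset.sum_congr rfl fun m hm => ?_
  obtain ⟨i, rfl⟩ := hf m hm
  rw [add_pow_char_pow, mul_add]

theorem aeval_zero {S : Type*} [CommRing S] [Algebra R S] (hf : IsTauPolynomial p f) :
    aeval (0 : S) f = 0 := by
  rw [aeval_def, eval₂_at_zero, hf.coeff_zero_eq_zero (Fact.out : p.Prime).ne_zero, map_zero]

theorem aeval_sum {S : Type*} [CommRing S] [Algebra R S] [CharP S p] (hf : IsTauPolynomial p f)
    {ι : Type*} (s : Finset ι) (x : ι → S) : aeval (∑ i ∈ s, x i) f = ∑ i ∈ s, aeval (x i) f := by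
  classical
  induction s using Finset.induction_on with
  | empty => simpa using hf.aeval_zero
  | insert a s ha ih => rw [Finset.sum_insert ha, Finset.sum_insert ha, hf.aeval_add, ih]

variable [CharP R p]

theorem pow_prime (hf : IsTauPolynomial p f) : IsTauPolynomial p (f ^ p) := by
  have hp : 0 < p := (Fact.out : p.Prime).pos
  refine of_coeff fun n hn => ?_
  rw [← map_frobenius_expand (p := p), coeff_map, coeff_expand hp] at hn
  split_ifs at hn with h
  · obtain ⟨i, hi⟩ := hf.exists_of_coeff_ne_zero fun h0 => hn (by rw [h0, map_zero])
    exact ⟨i + 1, by rw [pow_succ, ← hi, Nat.div_mul_cancel h]⟩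
  · simp at hn

theorem pow_prime_pow (hf : IsTauPolynomial p f) (i : ℕ) : IsTauPolynomial p (f ^ p ^ i) := by
  induction i with
  | zero => simpa using hf
  | succ i ih =>
    rw [pow_succ, pow_mul]
    exact ih.pow_prime

theorem comp (hf : IsTauPolynomial p f) (hg : IsTauPolynomial p g) :
    IsTauPolynomial p (f.comp g) := by
  rw [Polynomial.comp, eval₂_eq_sum, Polynomial.sum]
  refine sum _ _ fun m hm => ?_
  obtain ⟨i, rfl⟩ := hf m hm
  exact (hg.pow_prime_pow i).C_mul _

end CharP

section Field

variable {k : Type*} [Field k] {p : ℕ} [Fact p.Prime] [CharP k p] {f g : k[X]}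

/-- A Taylor shift of `f` changes only its constant term, so all Hasse derivatives of positive order
are constant: `choose n m * aₙ = 0` for `0 < m < n`. For `n = p ^ s * r` with `p ∤ r` and `m = p ^
s` the binomial coefficient is `r` modulo `p`, which forces `r = 1` when `aₙ ≠ 0`. -/
theorem of_eval_add [Infinite k] (h : ∀ x y, f.eval (x + y) = f.eval x + f.eval y) :
    IsTauPolynomial p f := by
  have hp : p.Prime := Fact.out
  have h0 : f.coeff 0 = 0 := by
    have := h 0 0
    rw [add_zero, left_eq_add] at this
    rwa [coeff_zero_eq_eval_zero]
  have htaylor : ∀ y, taylor y f = f + C (f.eval y) := fun y =>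
    Polynomial.funext fun x => by simp [taylor_eval, h]
  have hhasse : ∀ m, m ≠ 0 → hasseDeriv m f = C (f.coeff m) := fun m hm =>
    Polynomial.funext fun y => by
      rw [← taylor_coeff, htaylor, coeff_add, coeff_C_of_ne_zero hm, add_zero, eval_C]
  have hchoose : ∀ n m, 0 < m → m < n → (n.choose m : k) * f.coeff n = 0 := fun n m hm hmn => by
    have := congrArg (fun P => coeff P (n - m)) (hhasse m hm.ne')
    simpa [hasseDeriv_coeff, Nat.sub_add_cancel hmn.le, coeff_C_of_ne_zero (Nat.sub_pos_of_lt hmn).ne']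
      using this
  refine of_coeff fun n hn => ?_
  have hn0 : n ≠ 0 := by
    rintro rfl
    exact hn h0
  obtain ⟨s, r, hr, hnr⟩ := Nat.exists_eq_pow_mul_and_not_dvd hn0 p hp.ne_one
  have hps : 0 < p ^ s := pow_pos hp.pos s
  rcases Nat.lt_trichotomy r 1 with h1 | rfl | h1
  · obtain rfl : r = 0 := by omega
    simp at hr
  · exact ⟨s, by simpa using hnr⟩
  · exfalso
    have h2 := hchoose n (p ^ s) hps (by rw [hnr]; nlinarith)
    have h3 : (n.choose (p ^ s) : k) = r := by
      -- Compare coefficients in `(1 + X) ^ n = (1 + X ^ p ^ s) ^ r`.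
      have e : ((1 + X : k[X]) ^ n).coeff (p ^ s) = ((1 + X : k[X]) ^ r).coeff 1 := by
        rw [hnr, pow_mul, add_pow_char_pow, one_pow]
        have : (1 + X ^ p ^ s : k[X]) ^ r = expand k (p ^ s) ((1 + X) ^ r) := by simp
        rw [this, ← coeff_expand_mul hps ((1 + X : k[X]) ^ r) 1, one_mul]
      rw [coeff_one_add_X_pow, coeff_one_add_X_pow, Nat.choose_one_right] at e
      exact e
    rw [h3] at h2
    rcases mul_eq_zero.1 h2 with h4 | h4
    · exact hr ((CharP.cast_eq_zero_iff k p r).1 h4)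
    · exact hn h4

/-- Degrees are powers of `p`, so a monomial `c τ ^ (i - j)` composed with `g` can cancel the
leading term of `f`. This is right Euclidean division in the twisted polynomial ring. -/
theorem exists_comp_add (hf : IsTauPolynomial p f) (hg : IsTauPolynomial p g) (hg0 : g ≠ 0) :
    ∃ h r : k[X], IsTauPolynomial p h ∧ IsTauPolynomial p r ∧ f = h.comp g + r ∧
      r.degree < g.degree := by
  induction hd : f.degree using WellFoundedLT.induction generalizing f with
  | ind d ih =>
    subst hd
    by_cases hlt : f.degree < g.degree
    · exact ⟨0, f, zero, hf, by simp, hlt⟩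
    have hle : g.degree ≤ f.degree := not_lt.1 hlt
    have hf0 : f ≠ 0 := by
      rintro rfl
      rw [degree_zero, le_bot_iff, degree_eq_bot] at hle
      exact hg0 hle
    obtain ⟨i, hi⟩ := hf.exists_natDegree_eq hf0
    obtain ⟨j, hj⟩ := hg.exists_natDegree_eq hg0
    have hji : j ≤ i := by
      have := natDegree_le_natDegree hle
      rw [hi, hj] at this
      exact (Nat.pow_le_pow_iff_right (Fact.out : p.Prime).one_lt).1 this
    set u : k[X] := C (f.leadingCoeff / g.leadingCoeff ^ p ^ (i - j)) * X ^ p ^ (i - j) with hu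
    have hut : IsTauPolynomial p u := by
      refine C_mul _ (of_coeff fun n hn => ⟨i - j, ?_⟩)
      by_contra h
      exact hn (by rw [coeff_X_pow, if_neg h])
    have hcomp : u.comp g = C (f.leadingCoeff / g.leadingCoeff ^ p ^ (i - j)) * g ^ p ^ (i - j) := by
      simp [hu]
    have hgl : g.leadingCoeff ^ p ^ (i - j) ≠ 0 := pow_ne_zero _ (leadingCoeff_ne_zero.2 hg0)
    have hfl : f.leadingCoeff ≠ 0 := leadingCoeff_ne_zero.2 hf0
    have hlead : (u.comp g).leadingCoeff = f.leadingCoeff := by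
      rw [hcomp, leadingCoeff_mul, leadingCoeff_C, leadingCoeff_pow, div_mul_cancel₀ _ hgl]
    have hdeg : f.degree = (u.comp g).degree := by
      rw [degree_eq_natDegree hf0, hi, hcomp, degree_C_mul (div_ne_zero hfl hgl), degree_pow,
        degree_eq_natDegree hg0, hj, nsmul_eq_mul, ← Nat.cast_mul, ← pow_add,
        Nat.sub_add_cancel hji]
    obtain ⟨h, r, hh, hr, he, hrd⟩ := ih _ (degree_sub_lt_left hdeg hf0 hlead.symm)
      (hf.sub (hut.comp hg)) rfl
    refine ⟨h + u, r, hh.add hut, hr, ?_, hrd⟩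
    rw [add_comp, add_right_comm, ← he, sub_add_cancel]

/-- Commuting with scalars forces `c ^ p ^ i = c` on `F` for each exponent `p ^ i` that occurs. With
`#F = p ^ m` one may replace `i` by `i % m`; if this is nonzero, `X ^ p ^ (i % m) - X` has more
roots in `F` than its degree. -/
theorem of_comp_C_mul_X {F : Type*} [Field F] [Fintype F] (j : F →+* k)
    (hf : IsTauPolynomial p f)
    (h : ∀ c, f.comp (C (j c) * X) = (C (j c) * X).comp f) :
    IsTauPolynomial (Fintype.card F) f := by
  have hp : p.Prime := Fact.out
  have : CharP F p := (j.charP_iff j.injective p).2 inferInstance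
  obtain ⟨m, -, hcard⟩ := FiniteField.card F p
  intro n hn
  obtain ⟨i, rfl⟩ := hf n hn
  have hc : ∀ c : F, c ^ p ^ i = c := fun c => by
    have h1 := congrArg (fun P => coeff P (p ^ i)) (h c)
    simp only [comp_C_mul_X_coeff, mul_comp, C_comp, X_comp, coeff_C_mul] at h1
    rw [mul_comm] at h1
    exact j.injective (by rw [map_pow]; exact mul_right_cancel₀ (mem_support_iff.1 hn) h1)
  have hm : 0 < (m : ℕ) := m.pos
  have hcm : ∀ (c : F) (s : ℕ), c ^ (p ^ ((m : ℕ) * s)) = c := fun c s => by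
    induction s with
    | zero => simp
    | succ s ih => rw [mul_add, mul_one, pow_add, pow_mul, ih, ← hcard, FiniteField.pow_card]
  have hr : ∀ c : F, c ^ p ^ (i % m) = c := fun c => by
    have := hc c
    rwa [← Nat.div_add_mod i m, pow_add, pow_mul, hcm] at this
  have h0 : i % m = 0 := by
    by_contra h0
    have hlt : i % m < m := Nat.mod_lt _ hm
    have h1 : 1 < p ^ (i % m) := Nat.one_lt_pow h0 hp.one_lt
    have hne : (X ^ p ^ (i % m) - X : F[X]) ≠ 0 := FiniteField.X_pow_card_sub_X_ne_zero F h1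
    have hle : Fintype.card F ≤ (X ^ p ^ (i % m) - X : F[X]).natDegree := by
      have := card_le_degree_of_subset_roots (p := (X ^ p ^ (i % m) - X : F[X]))
        (Z := Finset.univ) (fun c _ => by simp [mem_roots hne, hr c])
      simpa using this
    rw [FiniteField.X_pow_card_sub_X_natDegree_eq F h1, hcard] at hle
    exact absurd ((Nat.pow_le_pow_iff_right hp.one_lt).1 hle) (by omega)
  exact ⟨i / m, by rw [hcard, ← pow_mul, Nat.mul_div_cancel' (Nat.dvd_of_mod_eq_zero h0)]⟩

end Field

end IsTauPolynomial

/-! ### Lowest-order terms of compositions, and elimination of a variable -/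

namespace Polynomial

variable {R : Type*} [CommRing R]

/-- Together with the next lemma, this compares the lowest-order terms on the two sides of an
identity `f ∘ φ_a = h ∘ f`. -/
theorem coeff_comp_of_forall_lt {f g : R[X]} {N : ℕ} (hf : ∀ n < N, f.coeff n = 0)
    (hg : g.coeff 0 = 0) : (f.comp g).coeff N = f.coeff N * g.coeff 1 ^ N := by
  obtain ⟨f, rfl⟩ := X_pow_dvd_iff.2 hf
  obtain ⟨g, rfl⟩ := X_dvd_iff.2 hg
  have : (X ^ N * f).comp (X * g) = X ^ N * (g ^ N * f.comp (X * g)) := by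
    rw [mul_comp, X_pow_comp, mul_pow, mul_assoc]
  have h1 : (X ^ N * f).coeff N = f.coeff 0 := by simpa using coeff_X_pow_mul f N 0
  have h2 := coeff_X_pow_mul (g ^ N * f.comp (X * g)) N 0
  rw [zero_add] at h2
  rw [this, h1, h2]
  simp [coeff_zero_eq_eval_zero, eval_comp, mul_comm]

theorem coeff_comp_of_forall_lt' {f h : R[X]} {N : ℕ} (hN : N ≠ 0) (hf : ∀ n < N, f.coeff n = 0)
    (hh : h.coeff 0 = 0) : (h.comp f).coeff N = h.coeff 1 * f.coeff N := by
  obtain ⟨f, rfl⟩ := X_pow_dvd_iff.2 hf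
  obtain ⟨h, rfl⟩ := X_dvd_iff.2 hh
  have : (X * h).comp (X ^ N * f) = X ^ N * (f * h.comp (X ^ N * f)) := by
    rw [mul_comp, X_comp, mul_assoc]
  have h1 : (X ^ N * f).coeff N = f.coeff 0 := by simpa using coeff_X_pow_mul f N 0
  have h2 := coeff_X_pow_mul (f * h.comp (X ^ N * f)) N 0
  rw [zero_add] at h2
  rw [this, h1, h2]
  simp [coeff_zero_eq_eval_zero, eval_comp, hN, mul_comm]

theorem comp_right_cancel [IsDomain R] {f g h : R[X]} (hh : h.natDegree ≠ 0)
    (H : f.comp h = g.comp h) : f = g := by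
  rw [← sub_eq_zero, ← sub_comp, comp_eq_zero_iff] at H
  rcases H with H | ⟨-, H⟩
  · exact sub_eq_zero.1 H
  · exact absurd (by rw [H, natDegree_C]) hh

end Polynomial

/-- A substitute for the resultant. The domain `R[X]/(F)` contains `R` and is algebraic over it,
because the class of `X` is a root of `F`. A nonzero ideal, here the one generated by `G`, therefore
meets `R` nontrivially. -/
theorem Polynomial.exists_C_eq_of_not_dvd {R : Type*} [CommRing R] [IsDomain R] {F G : R[X]}
    (hF : Prime F) (hC : ∀ r, F ∣ C r → r = 0) (hG : ¬ F ∣ G) :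
    ∃ r, r ≠ 0 ∧ ∃ a b, C r = a * F + b * G := by
  have := AdjoinRoot.isDomain_of_prime hF
  have hinj : Function.Injective (algebraMap R (AdjoinRoot F)) := by
    rw [injective_iff_map_eq_zero]
    intro r hr
    exact hC r (AdjoinRoot.mk_eq_zero.1 hr)
  have hx0 : AdjoinRoot.mk F G ≠ 0 := fun h => hG (AdjoinRoot.mk_eq_zero.1 h)
  have hroot : IsAlgebraic R (AdjoinRoot.root F) := ⟨F, hF.ne_zero, by simp⟩
  have hx : IsAlgebraic R (AdjoinRoot.mk F G) := by
    rw [← AdjoinRoot.aeval_eq]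
    have : aeval (AdjoinRoot.root F) G ∈ Subalgebra.algebraicClosure R (AdjoinRoot F) :=
      Subalgebra.aeval_coe _ (⟨AdjoinRoot.root F, hroot⟩ : Subalgebra.algebraicClosure R _) G ▸
        Subtype.coe_prop _
    exact this
  have hne := Ideal.comap_ne_bot_of_algebraic_mem hx0 (Ideal.mem_span_singleton_self _) hx
  obtain ⟨r, hr, hr0⟩ := Submodule.exists_mem_ne_zero_of_ne_bot hne
  refine ⟨r, hr0, ?_⟩
  obtain ⟨b, hb⟩ := Ideal.mem_span_singleton'.1 (Ideal.mem_comap.1 hr)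
  obtain ⟨b, rfl⟩ := AdjoinRoot.mk_surjective b
  have h : AdjoinRoot.mk F (C r - b * G) = 0 := by
    rw [map_sub, map_mul, hb, sub_eq_zero]
    rfl
  obtain ⟨a, ha⟩ := AdjoinRoot.mk_eq_zero.1 h
  exact ⟨a, b, by rw [mul_comm a, ← ha]; ring⟩

/-! ### Translates of a prime polynomial and its stabilizer -/

namespace MvPolynomial

section Translate

variable {σ R : Type*} [CommRing R]

/-- The translate `F(x + ζ)` of a polynomial `F`. -/
noncomputable def translate (ζ : σ → R) : MvPolynomial σ R →ₐ[R] MvPolynomial σ R :=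
  aeval fun i => X i + C (ζ i)

theorem eval_aeval (x : σ → R) {τ : Type*} (g : τ → MvPolynomial σ R) (F : MvPolynomial τ R) :
    eval x (aeval g F) = eval (fun i => eval x (g i)) F := by
  induction F using MvPolynomial.induction_on with
  | C a => simp
  | add p q hp hq => rw [map_add, map_add, map_add, hp, hq]
  | mul_X p i hp => rw [map_mul, map_mul, map_mul, hp, aeval_X, eval_X]

theorem eval_translate (ζ x : σ → R) (F : MvPolynomial σ R) :
    eval x (translate ζ F) = eval (x + ζ) F := by
  rw [translate, eval_aeval]
  congr 2
  ext i
  simp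

theorem translate_translate (ζ ξ : σ → R) (F : MvPolynomial σ R) :
    translate ζ (translate ξ F) = translate (ζ + ξ) F := by
  have : (translate ζ).comp (translate ξ) = translate (ζ + ξ) := by
    refine algHom_ext fun i => ?_
    simp [translate, add_assoc]
  exact congrArg (fun f => f F) this

theorem translate_zero (F : MvPolynomial σ R) : translate 0 F = F := by
  have : translate (0 : σ → R) = AlgHom.id R _ := algHom_ext fun i => by simp [translate]
  rw [this, AlgHom.id_apply]

theorem translate_neg_eq {ζ : σ → R} {F G : MvPolynomial σ R} (h : translate ζ F = G) :
    translate (-ζ) G = F := by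
  rw [← h, translate_translate, neg_add_cancel, translate_zero]

theorem prime_translate (ζ : σ → R) {F : MvPolynomial σ R} (hF : Prime F) :
    Prime (translate ζ F) := by
  let e : MvPolynomial σ R ≃ₐ[R] MvPolynomial σ R :=
    AlgEquiv.ofAlgHom (translate ζ) (translate (-ζ))
      (AlgHom.ext fun G => by simp [translate_translate, translate_zero])
      (AlgHom.ext fun G => by simp [translate_translate, translate_zero])
  exact (MulEquiv.prime_iff e.toMulEquiv).2 hF

theorem totalDegree_aeval_le {τ : Type*} {g : τ → MvPolynomial σ R} {D : ℕ}
    (hg : ∀ i, (g i).totalDegree ≤ D) (F : MvPolynomial τ R) :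
    (aeval g F).totalDegree ≤ F.totalDegree * D := by
  rw [aeval_def, eval₂_eq]
  refine totalDegree_finsetSum_le fun s hs => ?_
  rw [algebraMap_eq]
  refine (totalDegree_mul _ _).trans ?_
  rw [totalDegree_C, zero_add]
  refine (totalDegree_finsetProd _ _).trans ?_
  calc ∑ i ∈ s.support, (g i ^ s i).totalDegree ≤ ∑ i ∈ s.support, s i * D :=
        Finset.sum_le_sum fun i _ =>
          (totalDegree_pow _ _).trans (Nat.mul_le_mul_left _ (hg i))
    _ = (s.sum fun _ e => e) * D := by rw [← Finset.sum_mul]; rfl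
    _ ≤ F.totalDegree * D := Nat.mul_le_mul_right _ (le_totalDegree hs)

theorem totalDegree_translate_le (ζ : σ → R) (F : MvPolynomial σ R) :
    (translate ζ F).totalDegree ≤ F.totalDegree := by
  have h : ∀ i, (X i + C (ζ i) : MvPolynomial σ R).totalDegree ≤ 1 := fun i => by
    refine (totalDegree_add _ _).trans (max_le ?_ (by simp))
    cases subsingleton_or_nontrivial R
    · rw [Subsingleton.elim (X i : MvPolynomial σ R) 0]
      simp
    · rw [totalDegree_X]
  exact (totalDegree_aeval_le h F).trans_eq (mul_one _)

theorem totalDegree_translate (ζ : σ → R) (F : MvPolynomial σ R) :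
    (translate ζ F).totalDegree = F.totalDegree := by
  refine le_antisymm (totalDegree_translate_le ζ F) ?_
  have := totalDegree_translate_le (-ζ) (translate ζ F)
  rwa [translate_neg_eq rfl] at this

end Translate

section Field

variable {k : Type*} [Field k]

theorem totalDegree_ne_zero_of_prime {σ : Type*} {F : MvPolynomial σ k} (hF : Prime F) :
    F.totalDegree ≠ 0 := fun h => by
  rw [totalDegree_eq_zero_iff_eq_C] at h
  apply hF.not_isUnit
  rw [h, isUnit_map_iff, isUnit_iff_ne_zero]
  rintro h0
  rw [h0, C_0] at h
  exact hF.ne_zero h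

/-- Since `p • ζ = 0`, iterating the relation `p` times gives `F = u ^ p * F + c'`. As `F` is not
constant, `u ^ p = 1`, and in characteristic `p` this means `u = 1`. -/
theorem eq_one_of_translate_eq (p : ℕ) [Fact p.Prime] [CharP k p] {σ : Type*}
    {F : MvPolynomial σ k} (hF : F.totalDegree ≠ 0)
    {ζ : σ → k} {u c : k} (h : translate ζ F = C u * F + C c) : u = 1 := by
  have key : ∀ j : ℕ, ∃ c', translate (j • ζ) F = C (u ^ j) * F + C c' := fun j => by
    induction j with
    | zero => exact ⟨0, by simp [translate_zero]⟩
    | succ j ih =>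
      obtain ⟨c', hc'⟩ := ih
      refine ⟨u ^ j * c + c', ?_⟩
      rw [succ_nsmul', ← translate_translate, hc', map_add, map_mul, h]
      simp only [algHom_C, C_mul, C_add, pow_succ, algebraMap_eq]
      ring
  obtain ⟨c', hc'⟩ := key p
  have hp0 : p • ζ = 0 := by
    ext i
    simp
  rw [hp0, translate_zero] at hc'
  by_contra hu
  have hup : 1 - u ^ p ≠ 0 := fun h0 => by
    have : (1 - u) ^ p = 0 := by rw [sub_pow_char, one_pow, h0]
    exact hu (sub_eq_zero.1 (pow_eq_zero_iff (Fact.out : p.Prime).ne_zero |>.1 this)).symm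
  have hFc : F = C ((1 - u ^ p)⁻¹ * c') := by
    have h1 : C (1 - u ^ p) * F = C c' := by
      rw [C_sub, C_1, sub_mul, one_mul, sub_eq_iff_eq_add']
      exact hc'
    rw [C_mul, ← h1, ← mul_assoc, ← C_mul, inv_mul_cancel₀ hup, C_1, one_mul]
  exact hF (by rw [hFc, totalDegree_C])

theorem translate_eq_of_associated (p : ℕ) [Fact p.Prime] [CharP k p] {σ : Type*}
    {F : MvPolynomial σ k} (hF : F.totalDegree ≠ 0)
    {ζ : σ → k} (h : Associated F (translate ζ F)) : translate ζ F = F := by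
  obtain ⟨u, hu⟩ := h
  obtain ⟨c, -, hc⟩ := isUnit_iff_eq_C_of_isReduced.1 u.isUnit
  have h1 : translate ζ F = C c * F + C 0 := by rw [← hu, hc]; simp [mul_comm]
  have := eq_one_of_translate_eq p hF h1
  rw [h1, this]
  simp

/-- Distinct translates of `F` are non-associated primes, so their product divides `G`, and the
degree bound allows at most `#T` of them. Since `T ^ (n + 1)` permutes these translates, counting
orbits against stabilizers gives the claim. -/
theorem card_pow_le_card_stabilizer (p : ℕ) [Fact p.Prime] [CharP k p] {n : ℕ} [DecidableEq k] {F G : MvPolynomial (Fin (n + 1)) k}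
    (hF : Prime F) (hG0 : G ≠ 0) (T : AddSubgroup k) (T' : Finset k) (hT : (T' : Set k) = T)
    (hdeg : G.totalDegree ≤ F.totalDegree * T'.card)
    (hG : ∀ ζ : Fin (n + 1) → k, (∀ i, ζ i ∈ T) → translate ζ F ∣ G) :
    T'.card ^ n ≤
      ((Fintype.piFinset fun _ : Fin (n + 1) => T').filter fun ζ => translate ζ F = F).card := by
  classical
  have hmem : ∀ ζ : Fin (n + 1) → k, ζ ∈ (Fintype.piFinset fun _ => T') ↔ ∀ i, ζ i ∈ T := by
    intro ζ
    rw [Fintype.mem_piFinset]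
    exact forall_congr' fun i => by rw [← Finset.mem_coe, hT]; rfl
  have hd := totalDegree_ne_zero_of_prime hF
  set s := Fintype.piFinset fun _ : Fin (n + 1) => T' with hs
  set S := s.filter fun ζ => translate ζ F = F with hS
  -- Subtracting a fixed element embeds each fibre of `ζ ↦ translate ζ F` into the stabilizer.
  have h1 : s.card ≤ S.card * (s.image fun ζ => translate ζ F).card := by
    refine Finset.card_le_mul_card_image s _ fun H hH => ?_
    obtain ⟨ζ₀, hζ₀, rfl⟩ := Finset.mem_image.1 hH
    refine Finset.card_le_card_of_injOn (fun ζ => -ζ₀ + ζ) ?_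
      (fun a _ b _ hab => add_left_cancel hab)
    intro ζ hζ
    rw [Finset.mem_coe, Finset.mem_filter] at hζ
    refine Finset.mem_coe.2 (Finset.mem_filter.2 ⟨?_, ?_⟩)
    · rw [hmem] at hζ hζ₀ ⊢
      exact fun i => T.add_mem (T.neg_mem (hζ₀ i)) (hζ.1 i)
    · rw [← translate_translate, hζ.2, translate_neg_eq rfl]
  have h2 : (s.image fun ζ => translate ζ F).card ≤ T'.card := by
    have hdvd : ∏ H ∈ s.image (fun ζ => translate ζ F), H ∣ G := by
      refine Finset.prod_dvd_of_isRelPrime ?_ ?_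
      · intro H hH H' hH' hne
        obtain ⟨ζ, -, rfl⟩ := Finset.mem_image.1 hH
        obtain ⟨ζ', -, rfl⟩ := Finset.mem_image.1 hH'
        have hp := prime_translate ζ hF
        have hp' := prime_translate ζ' hF
        rw [Function.onFun, hp.irreducible.isRelPrime_iff_not_dvd]
        intro h
        apply hne
        have hass := hp.associated_of_dvd hp' h
        have e : translate ζ' F = translate (-ζ + ζ') (translate ζ F) := by
          rw [translate_translate]
          congr 2
          abel
        rw [e] at hass ⊢
        exact (translate_eq_of_associated p (by rwa [totalDegree_translate]) hass).symm
      · intro H hH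
        obtain ⟨ζ, hζ, rfl⟩ := Finset.mem_image.1 hH
        exact hG ζ ((hmem ζ).1 hζ)
    have hprod : ∀ I : Finset (MvPolynomial (Fin (n + 1)) k), I ⊆ s.image (fun ζ => translate ζ F) →
        (∏ H ∈ I, H).totalDegree = I.card * F.totalDegree ∧ ∏ H ∈ I, H ≠ 0 := by
      intro I
      induction I using Finset.induction_on with
      | empty => simp
      | insert H I hHI ih =>
        intro hsub
        obtain ⟨ih1, ih2⟩ := ih fun x hx => hsub (Finset.mem_insert_of_mem hx)
        obtain ⟨ζ, -, rfl⟩ := Finset.mem_image.1 (hsub (Finset.mem_insert_self H I))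
        have hne := (prime_translate ζ hF).ne_zero
        rw [Finset.prod_insert hHI, totalDegree_mul_of_isDomain hne ih2, ih1,
          totalDegree_translate, Finset.card_insert_of_notMem hHI]
        exact ⟨by ring, mul_ne_zero hne ih2⟩
    obtain ⟨Q, hQ⟩ := hdvd
    obtain ⟨e1, e2⟩ := hprod _ subset_rfl
    have hQ0 : Q ≠ 0 := by
      rintro rfl
      exact hG0 (by rw [hQ, mul_zero])
    rw [hQ, totalDegree_mul_of_isDomain e2 hQ0, e1] at hdeg
    refine Nat.le_of_mul_le_mul_left (c := F.totalDegree) ?_ (Nat.pos_of_ne_zero hd)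
    nlinarith
  have h3 : s.card = T'.card ^ (n + 1) := by
    rw [hs, Fintype.card_piFinset]
    simp
  have hpos : 0 < T'.card := by
    rw [Finset.card_pos]
    exact ⟨0, by rw [← Finset.mem_coe, hT]; exact T.zero_mem⟩
  refine Nat.le_of_mul_le_mul_right (c := T'.card) ?_ hpos
  calc T'.card ^ n * T'.card = s.card := by rw [h3, pow_succ]
    _ ≤ _ := h1
    _ ≤ _ := Nat.mul_le_mul_left _ h2

/-- Elimination of the variable `0`, by viewing polynomials in `n + 1` variables as polynomials in
that variable over the ring in the other `n`. -/
theorem exists_rename_succ_eq_of_not_dvd {n : ℕ} {F G : MvPolynomial (Fin (n + 1)) k}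
    (hF : Prime F) (hsucc : ∀ R : MvPolynomial (Fin n) k, F ∣ rename Fin.succ R → R = 0)
    (hG : ¬ F ∣ G) : ∃ R : MvPolynomial (Fin n) k, R ≠ 0 ∧ ∃ a b, rename Fin.succ R = a * F + b * G := by
  set e := finSuccEquiv k n with he
  have hren : ∀ R : MvPolynomial (Fin n) k, e (rename Fin.succ R) = Polynomial.C R := fun R => by
    induction R using MvPolynomial.induction_on with
    | C a => simp [he, finSuccEquiv_apply]
    | add p q hp hq => rw [map_add, map_add, hp, hq, Polynomial.C_add]
    | mul_X p i hp => rw [map_mul, map_mul, hp, rename_X, he, finSuccEquiv_X_succ, Polynomial.C_mul]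
  have hdvd : ∀ A B, e A ∣ e B ↔ A ∣ B := fun A B => map_dvd_iff e
  obtain ⟨r, hr0, a, b, h⟩ := Polynomial.exists_C_eq_of_not_dvd (F := e F) (G := e G)
    ((MulEquiv.prime_iff e.toMulEquiv).2 hF)
    (fun r hr => hsucc r (by rwa [← hren, hdvd] at hr)) (by rwa [hdvd])
  refine ⟨r, hr0, e.symm a, e.symm b, e.injective ?_⟩
  rw [hren, h]
  simp

end Field

end MvPolynomial

/-! ### A large stabilizer forces additivity -/

namespace MvPolynomial

section Stabilizer

variable {k : Type*} [Field k]

/-- Two elements of `S` with the same tail differ by a vector `(c, 0, …, 0)` that stabilizes `F`.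
Then `c` is a root of `F(X₀, y) - F(0, y)`, a nonzero polynomial in `X₀` because `F` really involves
that variable. So each fibre has at most `deg_{X₀} F` elements. -/
theorem card_le_natDegree_mul_card_image_tail [Infinite k] {n : ℕ} [DecidableEq k] {F : MvPolynomial (Fin (n + 1)) k}
    (hF : F ≠ 0) (hsucc : ∀ R : MvPolynomial (Fin n) k, F ∣ rename Fin.succ R → R = 0)
    (S : Finset (Fin (n + 1) → k)) (hS : ∀ ζ ∈ S, translate ζ F = F) :
    S.card ≤ (finSuccEquiv k n F).natDegree * (S.image Fin.tail).card := by
  set P := finSuccEquiv k n F with hP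
  set Q := P - Polynomial.C (P.eval 0) with hQ
  have hren : ∀ R : MvPolynomial (Fin n) k,
      finSuccEquiv k n (rename Fin.succ R) = Polynomial.C R := fun R => by
    induction R using MvPolynomial.induction_on with
    | C a => simp [finSuccEquiv_apply]
    | add p q hp hq => rw [map_add, map_add, hp, hq, Polynomial.C_add]
    | mul_X p i hp => rw [map_mul, map_mul, hp, rename_X, finSuccEquiv_X_succ, Polynomial.C_mul]
  have hQ0 : Q ≠ 0 := fun h => by
    have h1 : F = rename Fin.succ (P.eval 0) := (finSuccEquiv k n).injective (by
      rw [hren, ← hP]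
      exact sub_eq_zero.1 h)
    have h2 := hsucc _ (dvd_of_eq h1)
    rw [h2, map_zero] at h1
    exact hF h1
  have hQd : Q.natDegree ≤ P.natDegree := by
    rw [hQ, Polynomial.natDegree_sub_C]
  refine Finset.card_le_mul_card_image S _ fun y hy => ?_
  obtain ⟨ζ₀, hζ₀, rfl⟩ := Finset.mem_image.1 hy
  refine le_trans ?_ hQd
  refine le_trans ?_ (Q.card_roots' )
  refine le_trans ?_ (Multiset.toFinset_card_le _)
  refine Finset.card_le_card_of_injOn (fun ζ => C (ζ 0 - ζ₀ 0)) ?_ ?_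
  · intro ζ hζ
    rw [Finset.mem_coe, Finset.mem_filter] at hζ
    rw [Finset.mem_coe, Multiset.mem_toFinset, Polynomial.mem_roots hQ0, Polynomial.IsRoot.def, hQ,
      Polynomial.eval_sub, Polynomial.eval_C, sub_eq_zero]
    have hstab : translate (ζ - ζ₀) F = F := by
      have h1 := translate_neg_eq (hS ζ₀ hζ₀)
      rw [sub_eq_add_neg, ← translate_translate, h1, hS ζ hζ.1]
    have hcons : ∀ y : Fin n → k, ∀ a, eval (Fin.cons a y : Fin (n + 1) → k) F =
        eval y (P.eval (C a)) := fun y a => by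
      rw [eval_eq_eval_mv_eval', ← hP, Polynomial.eval_map, ← Polynomial.eval₂_at_apply,
        eval_C]
    refine MvPolynomial.funext fun y => ?_
    rw [← hcons, ← C_0 (σ := Fin n), ← hcons]
    conv_rhs => rw [← hstab, eval_translate]
    congr 2
    ext i
    refine Fin.cases ?_ (fun j => ?_) i
    · simp
    · have := congrFun hζ.2 j
      simp only [Fin.tail] at this
      simp [this]
  · intro ζ hζ ζ' hζ' h
    rw [Finset.mem_coe, Finset.mem_filter] at hζ hζ'
    have h0 := C_injective _ _ h
    ext i
    refine Fin.cases ?_ (fun j => ?_) i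
    · exact sub_left_injective h0
    · exact congrFun (hζ.2.trans hζ'.2.symm) j

/-- A family of arbitrarily large finite subgroups `T` of `k` such that the translates of `F` by
`T ^ (n + 1)` all divide a nonzero polynomial of degree at most `#T * deg F`. -/
def HasManyTranslates {n : ℕ} (F : MvPolynomial (Fin (n + 1)) k) : Prop :=
  ∀ B : ℕ, ∃ (T : AddSubgroup k) (T' : Finset k) (G : MvPolynomial (Fin (n + 1)) k),
    (T' : Set k) = T ∧ B ≤ T'.card ∧ G ≠ 0 ∧ G.totalDegree ≤ F.totalDegree * T'.card ∧
      ∀ ζ : Fin (n + 1) → k, (∀ i, ζ i ∈ T) → translate ζ F ∣ G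

/-- The stabilizer is Zariski dense in the hypersurface `F = 0`. Otherwise elimination gives a
nonzero `R` in the last `n` variables that vanishes on the tails of stabilizing vectors.
Schwartz–Zippel leaves at most about `deg R * #T ^ (n - 1)` tails in `T ^ n`, while there are at
least `#T ^ n / d`. -/
theorem dvd_of_forall_stabilizer [Infinite k] (p : ℕ) [Fact p.Prime] [CharP k p] {n : ℕ}
    {F G : MvPolynomial (Fin (n + 1)) k} (hF : Prime F) (h0 : eval 0 F = 0)
    (hsucc : ∀ R : MvPolynomial (Fin n) k, F ∣ rename Fin.succ R → R = 0)
    (hT : HasManyTranslates F) (hG : ∀ ζ, translate ζ F = F → eval ζ G = 0) : F ∣ G := by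
  classical
  by_contra hdvd
  obtain ⟨R, hR0, a, b, hR⟩ := exists_rename_succ_eq_of_not_dvd hF hsucc hdvd
  set d := (finSuccEquiv k n F).natDegree with hd
  -- The counting bounds below yield `#T ≤ d * deg R`, so this size is a contradiction.
  obtain ⟨T, T', H, hTT, hB, hH0, hHdeg, hH⟩ := hT (d * R.totalDegree + 1)
  have h1 := card_pow_le_card_stabilizer p hF hH0 T T' hTT hHdeg hH
  set S := (Fintype.piFinset fun _ : Fin (n + 1) => T').filter fun ζ => translate ζ F = F with hS
  have h2 := card_le_natDegree_mul_card_image_tail hF.ne_zero hsucc S fun ζ hζ => (Finset.mem_filter.1 hζ).2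
  have hsub : S.image Fin.tail ⊆
      (Fintype.piFinset fun _ : Fin n => T').filter fun y => eval y R = 0 := by
    intro y hy
    obtain ⟨ζ, hζ, rfl⟩ := Finset.mem_image.1 hy
    obtain ⟨hζT, hζF⟩ := Finset.mem_filter.1 hζ
    rw [Finset.mem_filter, Fintype.mem_piFinset]
    refine ⟨fun i => Fintype.mem_piFinset.1 hζT i.succ, ?_⟩
    have h3 : eval ζ F = 0 := by
      rw [← h0]
      conv_rhs => rw [← hζF, eval_translate, zero_add]
    have h4 := congrArg (eval ζ) hR
    rw [map_add, map_mul, map_mul, h3, hG ζ hζF, mul_zero, mul_zero, add_zero, eval_rename] at h4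
    exact h4
  have hTpos : 0 < T'.card := by omega
  have h5 : (S.image Fin.tail).card * T'.card ≤ R.totalDegree * T'.card ^ n := by
    have hsz := schwartz_zippel_totalDegree hR0 T'
    have hpos : (0 : ℚ≥0) < T'.card := by exact_mod_cast hTpos
    rw [div_le_div_iff₀ (by positivity) hpos] at hsz
    have hsz' : ((Fintype.piFinset fun _ : Fin n => T').filter fun y => eval y R = 0).card * T'.card ≤ R.totalDegree * T'.card ^ n := by exact_mod_cast hsz
    exact (Nat.mul_le_mul_right _ (Finset.card_le_card hsub)).trans hsz'
  have h6 : T'.card ^ n * T'.card ≤ T'.card ^ n * (d * R.totalDegree) := by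
    calc T'.card ^ n * T'.card ≤ d * (S.image Fin.tail).card * T'.card :=
          Nat.mul_le_mul_right _ (h1.trans h2)
      _ = d * ((S.image Fin.tail).card * T'.card) := by ring
      _ ≤ d * (R.totalDegree * T'.card ^ n) := Nat.mul_le_mul_left _ h5
      _ = _ := by ring
  have := Nat.le_of_mul_le_mul_left h6 (pow_pos hTpos n)
  omega

/-- For fixed `x` the polynomial `F(y + x) - F(x)` vanishes at every stabilizing `y`, hence is a
multiple of `F`. By degree the factor is a constant, and `eq_one_of_translate_eq` shows that it is
`1`. -/
theorem eval_add_of_forall_stabilizer (p : ℕ) [Fact p.Prime] [CharP k p] {σ : Type*}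
    {F : MvPolynomial σ k} (hF : Prime F)
    (hdvd : ∀ G, (∀ ζ, translate ζ F = F → eval ζ G = 0) → F ∣ G) (x y : σ → k) :
    eval (x + y) F = eval x F + eval y F := by
  have hd := totalDegree_ne_zero_of_prime hF
  obtain ⟨u, hu⟩ := hdvd (translate x F - C (eval x F)) fun ζ hζ => by
    rw [map_sub, eval_C, eval_translate, add_comm, ← eval_translate, hζ, sub_self]
  have hu0 : u.totalDegree = 0 := by
    by_cases h : u = 0
    · rw [h, totalDegree_zero]
    have h1 := totalDegree_mul_of_isDomain hF.ne_zero h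
    rw [← hu] at h1
    have h2 : (translate x F - C (eval x F)).totalDegree ≤ F.totalDegree :=
      (totalDegree_sub_C_le _ _).trans (totalDegree_translate_le x F)
    omega
  rw [totalDegree_eq_zero_iff_eq_C] at hu0
  rw [hu0] at hu
  have h1 : translate x F = C (coeff 0 u) * F + C (eval x F) := by
    rw [mul_comm, ← hu, sub_add_cancel]
  rw [eq_one_of_translate_eq p hd h1] at h1
  have h2 := congrArg (eval y) h1
  rw [eval_translate] at h2
  simpa [add_comm] using h2

end Stabilizer

section Additive

variable {k : Type*} [Field k] [Infinite k]

/-- The `fᵢ` are the restrictions of `F` to the coordinate axes. -/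
theorem exists_eq_sum_aeval_X (p : ℕ) [Fact p.Prime] [CharP k p] {σ : Type*} [Fintype σ]
    {F : MvPolynomial σ k} (h : ∀ x y, eval (x + y) F = eval x F + eval y F) :
    ∃ f : σ → k[X], (∀ i, IsTauPolynomial p (f i)) ∧
      F = ∑ i, Polynomial.aeval (X i : MvPolynomial σ k) (f i) := by
  classical
  have h0 : eval (0 : σ → k) F = 0 := by simpa using h 0 0
  have heval : ∀ i x, (aeval (Pi.single i Polynomial.X : σ → k[X]) F).eval x =
      eval (Pi.single i x) F := fun i x => by
    rw [← Polynomial.coe_evalRingHom, ← MvPolynomial.aeval_eq_eval, ← RingHom.coe_coe,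
      ← Polynomial.coe_aeval_eq_evalRingHom, RingHom.coe_coe, RingHom.coe_coe, ← AlgHom.comp_apply]
    congr 1
    refine algHom_ext fun j => ?_
    rcases eq_or_ne j i with rfl | hj
    · simp
    · simp [Pi.single_eq_of_ne hj]
  have hsum : ∀ (s : Finset σ) (x : σ → σ → k), eval (∑ i ∈ s, x i) F = ∑ i ∈ s, eval (x i) F := by
    intro s x
    induction s using Finset.induction_on with
    | empty => simpa using h0
    | insert a s ha ih => rw [Finset.sum_insert ha, Finset.sum_insert ha, h, ih]
  refine ⟨fun i => aeval (Pi.single i Polynomial.X : σ → k[X]) F, fun i => ?_, ?_⟩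
  · refine IsTauPolynomial.of_eval_add fun x y => ?_
    rw [heval, heval, heval, Pi.single_add, h]
  · refine MvPolynomial.funext fun x => ?_
    conv_lhs => rw [← Finset.univ_sum_single x]
    rw [hsum, map_sum]
    refine Finset.sum_congr rfl fun i _ => ?_
    rw [← heval, ← MvPolynomial.aeval_eq_eval, ← Polynomial.aeval_algHom_apply,
      aeval_X, Polynomial.coe_aeval_eq_eval]

end Additive

end MvPolynomial

/-! ### The polynomials `φ_a` over extensions of `K`: separability, kernels, torsion -/

namespace DrinfeldModule

variable {𝔽 K : Type*} [Field 𝔽] [Fintype 𝔽] [Field K] [Algebra 𝔽[X] K]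

section BaseChange

variable (φ : DrinfeldModule 𝔽 K) (E : Type*) [Field E] [Algebra K E]

/-- The polynomial `φ_a` with coefficients in an extension `E` of `K`. -/
noncomputable def poly (a : 𝔽[X]) : E[X] := (φ.toFun a).map (algebraMap K E)

theorem isTauPolynomial_poly (a : 𝔽[X]) : IsTauPolynomial (Fintype.card 𝔽) (φ.poly E a) :=
  (φ.isTauPolynomial' a).map _

theorem poly_add (a b : 𝔽[X]) : φ.poly E (a + b) = φ.poly E a + φ.poly E b := by
  rw [poly, φ.map_add', Polynomial.map_add]; rfl

theorem poly_zero : φ.poly E 0 = 0 := by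
  rw [poly, φ.toFun_zero, Polynomial.map_zero]

theorem poly_mul (a b : 𝔽[X]) : φ.poly E (a * b) = (φ.poly E a).comp (φ.poly E b) := by
  rw [poly, φ.map_mul', Polynomial.map_comp]; rfl

theorem poly_one : φ.poly E 1 = X := by
  rw [poly, φ.map_one', Polynomial.map_X]

theorem coeff_one_poly (a : 𝔽[X]) :
    (φ.poly E a).coeff 1 = algebraMap K E (algebraMap 𝔽[X] K a) := by
  rw [poly, coeff_map, φ.coeff_one']

theorem coeff_zero_poly (a : 𝔽[X]) : (φ.poly E a).coeff 0 = 0 :=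
  (φ.isTauPolynomial_poly E a).coeff_zero_eq_zero Fintype.card_ne_zero

theorem act_eq_eval_poly (a : 𝔽[X]) (x : E) : φ.act a x = (φ.poly E a).eval x := by
  rw [act, aeval_def, poly, eval_map]

/-- For `c ≠ 0` the polynomial `φ_c` is invertible under composition, hence of degree one. -/
theorem poly_C (c : 𝔽) :
    φ.poly E (C c) = C (algebraMap K E (algebraMap 𝔽[X] K (C c))) * X := by
  by_cases hc : c = 0
  · rw [hc, C_0, poly_zero, map_zero, map_zero, C_0, zero_mul]
  have h := φ.poly_mul E (C c) (C c⁻¹)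
  rw [← C_mul, mul_inv_cancel₀ hc, C_1, poly_one] at h
  have h := congrArg natDegree h
  rw [natDegree_X, natDegree_comp] at h
  have h1 := Nat.eq_one_of_mul_eq_one_right h.symm
  rw [eq_X_add_C_of_natDegree_le_one h1.le, coeff_zero_poly, coeff_one_poly, C_0, add_zero]

variable {E} in
theorem algebraMap_act {E' : Type*} [Field E'] [Algebra K E'] [Algebra E E'] [IsScalarTower K E E']
    (a : 𝔽[X]) (x : E) : algebraMap E E' (φ.act a x) = φ.act a (algebraMap E E' x) := by
  rw [act, act, ← aeval_algebraMap_apply]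

end BaseChange

theorem act_add_left (φ : DrinfeldModule 𝔽 K) {E : Type*} [Field E] [Algebra K E] (a b : 𝔽[X])
    (x : E) : φ.act (a + b) x = φ.act a x + φ.act b x := by
  rw [act_eq_eval_poly, poly_add, eval_add, ← act_eq_eval_poly, ← act_eq_eval_poly]

theorem act_zero_left (φ : DrinfeldModule 𝔽 K) {E : Type*} [Field E] [Algebra K E]
    (x : E) : φ.act 0 x = 0 := by
  rw [act_eq_eval_poly, poly_zero, eval_zero]

theorem act_one (φ : DrinfeldModule 𝔽 K) {E : Type*} [Field E] [Algebra K E]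
    (x : E) : φ.act 1 x = x := by
  rw [act_eq_eval_poly, poly_one, eval_X]

theorem act_sub_left (φ : DrinfeldModule 𝔽 K) {E : Type*} [Field E] [Algebra K E] (a b : 𝔽[X])
    (x : E) : φ.act (a - b) x = φ.act a x - φ.act b x := by
  rw [eq_sub_iff_add_eq, ← act_add_left, sub_add_cancel]

theorem act_sum_right (φ : DrinfeldModule 𝔽 K) {E : Type*} [Field E] [Algebra K E] (a : 𝔽[X])
    {ι : Type*} (s : Finset ι) (x : ι → E) :
    φ.act a (∑ i ∈ s, x i) = ∑ i ∈ s, φ.act a (x i) := by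
  classical
  induction s using Finset.induction_on with
  | empty => simpa using φ.act_zero_right a
  | insert a s ha ih => rw [Finset.sum_insert ha, Finset.sum_insert ha, act_add_right, ih]

section Separable

variable (φ : DrinfeldModule 𝔽 K)

theorem algebraMap_ne_zero (𝔽 K L : Type*) [Field 𝔽] [Fintype 𝔽] [Field K] [Algebra 𝔽[X] K]
    [NormedField L] [Algebra K L] [ExtendsDegreeNorm 𝔽 K L] {a : 𝔽[X]} (ha : a ≠ 0) :
    algebraMap K L (algebraMap 𝔽[X] K a) ≠ 0 := by
  rw [← norm_ne_zero_iff, ExtendsDegreeNorm.norm_algebraMap a ha]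
  exact pow_ne_zero _ (Nat.cast_ne_zero.2 Fintype.card_ne_zero)

theorem algebraMap_base_injective (𝔽 K L : Type*) [Field 𝔽] [Fintype 𝔽] [Field K] [Algebra 𝔽[X] K]
    [NormedField L] [Algebra K L] [ExtendsDegreeNorm 𝔽 K L] :
    Function.Injective (algebraMap 𝔽[X] K) := by
  rw [injective_iff_map_eq_zero]
  intro a h
  by_contra ha
  exact algebraMap_ne_zero 𝔽 K L ha (by rw [h, map_zero])

theorem charP_of_algebra (𝔽 K E : Type*) [Field 𝔽] [Field K] [Algebra 𝔽[X] K]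
    [Field E] [Algebra K E] (p : ℕ) [CharP 𝔽 p] : CharP E p :=
  let f : 𝔽 →+* E := (algebraMap K E).comp ((algebraMap 𝔽[X] K).comp C)
  (f.charP_iff f.injective p).1 inferInstance

theorem exists_prime_card_eq (𝔽 : Type*) [Field 𝔽] [Fintype 𝔽] :
    ∃ p m : ℕ, ∃ _ : Fact p.Prime, ∃ _ : CharP 𝔽 p, Fintype.card 𝔽 = p ^ m := by
  obtain ⟨p, hp⟩ := CharP.exists 𝔽
  obtain ⟨n, hprime, hcard⟩ := FiniteField.card 𝔽 p
  exact ⟨p, n, ⟨hprime⟩, hp, hcard⟩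

theorem _root_.IsTauPolynomial.derivative_eq {R : Type*} [CommRing R] {p : ℕ} [CharP R p]
    {f : R[X]} (hf : IsTauPolynomial p f) : derivative f = C (f.coeff 1) := by
  ext n
  rw [coeff_derivative, coeff_C]
  split_ifs with hn
  · simp [hn]
  · by_cases h : f.coeff (n + 1) = 0
    · rw [h, zero_mul]
    · obtain ⟨i, hi⟩ := hf.exists_of_coeff_ne_zero h
      have hi0 : i ≠ 0 := by
        rintro rfl
        simp at hi
        exact hn hi
      have : ((n : R) + 1) = 0 := by
        rw [← Nat.cast_succ, Nat.succ_eq_add_one, hi, Nat.cast_pow, CharP.cast_eq_zero,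
          zero_pow hi0]
      rw [this, mul_zero]

/-- The derivative is the nonzero constant `f.coeff 1`. In generic characteristic this applies to
all `φ_a` with `a ≠ 0`, so torsion is separable and `ker φ_a` has exactly `deg φ_a` elements over a
separably closed field. -/
theorem _root_.IsTauPolynomial.separable_add_C {E : Type*} [Field E] {p : ℕ} [CharP E p]
    {f : E[X]} (hf : IsTauPolynomial p f) (h1 : f.coeff 1 ≠ 0) (c : E) : (f + C c).Separable := by
  rw [Separable, derivative_add, derivative_C, add_zero, hf.derivative_eq]
  exact isCoprime_one_right.of_isCoprime_of_dvd_right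
    (isUnit_C.2 (isUnit_iff_ne_zero.2 h1)).dvd

variable (E : Type*) [Field E] [Algebra K E]

theorem isTauPolynomial_char (p : ℕ) [Fact p.Prime] [CharP 𝔽 p] (a : 𝔽[X]) :
    IsTauPolynomial p (φ.poly E a) := by
  obtain ⟨n, -, hcard⟩ := FiniteField.card 𝔽 p
  have := φ.isTauPolynomial_poly E a
  rw [hcard] at this
  exact this.of_pow

theorem coeff_one_poly_ne_zero (hi : Function.Injective (algebraMap 𝔽[X] K)) {a : 𝔽[X]}
    (ha : a ≠ 0) : (φ.poly E a).coeff 1 ≠ 0 := by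
  rw [coeff_one_poly]
  exact (_root_.map_ne_zero _).2 fun h => ha (hi (by rw [h, map_zero]))

theorem poly_ne_zero (hi : Function.Injective (algebraMap 𝔽[X] K)) {a : 𝔽[X]}
    (ha : a ≠ 0) : φ.poly E a ≠ 0 := fun h =>
  φ.coeff_one_poly_ne_zero E hi ha (by rw [h, coeff_zero])

theorem natDegree_poly_pos (hi : Function.Injective (algebraMap 𝔽[X] K)) {a : 𝔽[X]}
    (ha : a ≠ 0) : 0 < (φ.poly E a).natDegree :=
  le_natDegree_of_ne_zero (φ.coeff_one_poly_ne_zero E hi ha)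

theorem separable_poly_add_C (hi : Function.Injective (algebraMap 𝔽[X] K)) {a : 𝔽[X]}
    (ha : a ≠ 0) (c : E) : (φ.poly E a + C c).Separable := by
  obtain ⟨p, -, _, _, -⟩ := exists_prime_card_eq 𝔽
  have := charP_of_algebra 𝔽 K E p
  exact (φ.isTauPolynomial_char E p a).separable_add_C (φ.coeff_one_poly_ne_zero E hi ha) c

theorem separable_poly (hi : Function.Injective (algebraMap 𝔽[X] K)) {a : 𝔽[X]}
    (ha : a ≠ 0) : (φ.poly E a).Separable := by
  simpa using φ.separable_poly_add_C E hi ha 0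

theorem act_surjective [IsSepClosed E] (hi : Function.Injective (algebraMap 𝔽[X] K)) {a : 𝔽[X]}
    (ha : a ≠ 0) (y : E) : ∃ x : E, φ.act a x = y := by
  obtain ⟨x, hx⟩ := IsSepClosed.exists_root (φ.poly E a + C (-y))
    (by
      rw [degree_add_C (natDegree_pos_iff_degree_pos.1 (φ.natDegree_poly_pos E hi ha))]
      exact (natDegree_pos_iff_degree_pos.1 (φ.natDegree_poly_pos E hi ha)).ne')
    (φ.separable_poly_add_C E hi ha _)
  refine ⟨x, ?_⟩
  rw [IsRoot.def, eval_add, eval_C, ← act_eq_eval_poly] at hx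
  rw [← sub_eq_zero, sub_eq_add_neg, hx]

/-- The kernel of `φ_a`. -/
def ker (a : 𝔽[X]) : AddSubgroup E where
  carrier := {x | φ.act a x = 0}
  zero_mem' := φ.act_zero_right a
  add_mem' := fun {x y} hx hy => by
    rw [Set.mem_ofPred_eq] at hx hy ⊢
    rw [act_add_right, hx, hy, add_zero]
  neg_mem' := fun {x} hx => by
    rw [Set.mem_ofPred_eq] at hx ⊢
    rw [act_neg_right, hx, neg_zero]

theorem mem_roots_poly (hi : Function.Injective (algebraMap 𝔽[X] K)) {a : 𝔽[X]} (ha : a ≠ 0)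
    {x : E} : x ∈ (φ.poly E a).roots ↔ φ.act a x = 0 := by
  rw [mem_roots (φ.poly_ne_zero E hi ha), IsRoot.def, act_eq_eval_poly]

theorem card_roots_poly [DecidableEq E] [IsSepClosed E]
    (hi : Function.Injective (algebraMap 𝔽[X] K)) {a : 𝔽[X]}
    (ha : a ≠ 0) : (φ.poly E a).roots.toFinset.card = (φ.poly E a).natDegree := by
  rw [Multiset.toFinset_card_of_nodup (nodup_roots (φ.separable_poly E hi ha)),
    (IsSepClosed.splits_of_separable _ (φ.separable_poly E hi ha)).natDegree_eq_card_roots]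

theorem natDegree_poly_pow (a : 𝔽[X]) (n : ℕ) :
    (φ.poly E (a ^ n)).natDegree = (φ.poly E a).natDegree ^ n := by
  induction n with
  | zero => rw [pow_zero, pow_zero, poly_one, natDegree_X]
  | succ n ih => rw [pow_succ, pow_succ, poly_mul, natDegree_comp, ih]

theorem exists_le_natDegree_poly (B : ℕ) :
    ∃ a : 𝔽[X], a ≠ 0 ∧ B ≤ (φ.poly E a).natDegree := by
  obtain ⟨a, ha, hdeg⟩ := φ.exists_natDegree
  have ha0 : a ≠ 0 := by
    rintro rfl
    simp at ha
  refine ⟨a ^ B, pow_ne_zero _ ha0, ?_⟩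
  rw [natDegree_poly_pow, poly, natDegree_map]
  exact (Nat.lt_pow_self hdeg).le

theorem infinite_torsion [IsSepClosed E] (hi : Function.Injective (algebraMap 𝔽[X] K)) :
    (φ.torsion E : Set E).Infinite := by
  classical
  intro hfin
  obtain ⟨a, ha, hdeg⟩ := φ.exists_le_natDegree_poly E (hfin.toFinset.card + 1)
  rw [← φ.card_roots_poly E hi ha] at hdeg
  have : (φ.poly E a).roots.toFinset ⊆ hfin.toFinset := fun x hx => by
    rw [Multiset.mem_toFinset, φ.mem_roots_poly E hi ha] at hx
    exact hfin.mem_toFinset.2 ⟨a, ha, hx⟩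
  have := Finset.card_le_card this
  omega

theorem infinite_of_algebra (𝔽 K E : Type*) [Field 𝔽] [Field K] [Algebra 𝔽[X] K]
    [Field E] [Algebra K E] (hi : Function.Injective (algebraMap 𝔽[X] K)) : Infinite E :=
  Infinite.of_injective (fun a : 𝔽[X] => algebraMap K E (algebraMap 𝔽[X] K a))
    fun _ _ h => hi ((algebraMap K E).injective h)

theorem mem_separableClosure_of_act_eq_zero (hi : Function.Injective (algebraMap 𝔽[X] K))
    {a : 𝔽[X]} (ha : a ≠ 0) {x : E} (hx : φ.act a x = 0) : x ∈ separableClosure K E := by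
  rw [mem_separableClosure_iff]
  have h := φ.separable_poly K hi ha
  refine h.of_dvd (minpoly.dvd K x ?_)
  rw [poly, Algebra.algebraMap_self, Polynomial.map_id]
  exact hx

end Separable

end DrinfeldModule

/-! ### Divisibility between additive polynomials in several variables -/

namespace MvPolynomial

theorem finSuccEquiv_sum_aeval_X {k : Type*} [CommRing k] {n : ℕ} (f : Fin (n + 1) → k[X]) :
    finSuccEquiv k n (∑ i, Polynomial.aeval (X i : MvPolynomial (Fin (n + 1)) k) (f i)) =
      (f 0).map MvPolynomial.C +
        Polynomial.C (∑ i : Fin n, Polynomial.aeval (X i : MvPolynomial (Fin n) k) (f i.succ)) := by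
  rw [Fin.sum_univ_succ, map_add, map_sum, map_sum]
  congr 1
  · rw [← Polynomial.aeval_algHom_apply, finSuccEquiv_X_zero, Polynomial.aeval_def,
      Polynomial.map, Polynomial.eval₂_eq_sum, Polynomial.eval₂_eq_sum]
    rfl
  · refine Finset.sum_congr rfl fun i _ => ?_
    rw [← Polynomial.aeval_algHom_apply, finSuccEquiv_X_succ]
    have := Polynomial.aeval_algHom_apply
      (IsScalarTower.toAlgHom k (MvPolynomial (Fin n) k) (MvPolynomial (Fin n) k)[X])
      (X i : MvPolynomial (Fin n) k) (f i.succ)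
    exact this

/-- Viewed as polynomials in the variable `0`, the divisor has degree `deg f₀` and the dividend a
smaller one. -/
theorem sum_aeval_X_eq_zero_of_dvd {k : Type*} [Field k] {n : ℕ} (f g : Fin (n + 1) → k[X])
    (hdeg : (g 0).degree < (f 0).degree) (hf : (f 0).natDegree ≠ 0)
    (hdvd : ∑ i, Polynomial.aeval (X i : MvPolynomial (Fin (n + 1)) k) (f i) ∣
      ∑ i, Polynomial.aeval (X i : MvPolynomial (Fin (n + 1)) k) (g i)) :
    ∑ i, Polynomial.aeval (X i : MvPolynomial (Fin (n + 1)) k) (g i) = 0 := by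
  have h := (map_dvd_iff (finSuccEquiv k n)).2 hdvd
  rw [finSuccEquiv_sum_aeval_X, finSuccEquiv_sum_aeval_X] at h
  refine (finSuccEquiv k n).injective ?_
  rw [map_zero, finSuccEquiv_sum_aeval_X]
  refine Polynomial.eq_zero_of_dvd_of_degree_lt h ?_
  have hpos : 0 < (f 0).degree := natDegree_pos_iff_degree_pos.1 (Nat.pos_of_ne_zero hf)
  have hC : Function.Injective (MvPolynomial.C : k →+* MvPolynomial (Fin n) k) := C_injective _ _
  have hF : ((f 0).map MvPolynomial.C + Polynomial.C (∑ i : Fin n,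
      Polynomial.aeval (X i : MvPolynomial (Fin n) k) (f i.succ))).degree = (f 0).degree := by
    rw [Polynomial.degree_add_C (by rwa [Polynomial.degree_map_eq_of_injective hC]),
      Polynomial.degree_map_eq_of_injective hC]
  rw [hF]
  refine (Polynomial.degree_add_le _ _).trans_lt (max_lt ?_ ?_)
  · rwa [Polynomial.degree_map_eq_of_injective hC]
  · exact Polynomial.degree_C_le.trans_lt hpos

theorem eq_zero_of_sum_aeval_X_eq_zero {k : Type*} [Field k] [Infinite k] {σ : Type*} [Fintype σ]
    (g : σ → k[X]) (hg : ∀ i, (g i).coeff 0 = 0)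
    (h : ∑ i, Polynomial.aeval (X i : MvPolynomial σ k) (g i) = 0) (i : σ) : g i = 0 := by
  classical
  refine Polynomial.funext fun x => ?_
  have h1 := congrArg (MvPolynomial.aeval (Pi.single i x : σ → k)) h
  rw [map_sum, map_zero, Finset.sum_eq_single i] at h1
  · rw [← Polynomial.aeval_algHom_apply, aeval_X, Pi.single_eq_same,
      Polynomial.coe_aeval_eq_eval] at h1
    rw [h1, Polynomial.eval_zero]
  · intro j _ hj
    rw [← Polynomial.aeval_algHom_apply, aeval_X, Pi.single_eq_of_ne hj,
      Polynomial.coe_aeval_eq_eval, ← Polynomial.coeff_zero_eq_eval_zero, hg]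
  · intro h
    exact absurd (Finset.mem_univ i) h

/-- If a polynomial `∑ fᵢ(xᵢ)` generates the vanishing ideal of a set of points, then its exponents
are not all divisible by `p`. -/
theorem exists_coeff_ne_zero_of_forall_dvd {k : Type*} [Field k] [Infinite k] (p : ℕ) [Fact p.Prime]
    [CharP k p] {n : ℕ} (f : Fin (n + 1) → k[X]) (hf0 : (f 0).natDegree ≠ 0)
    (hf : ∀ i, IsTauPolynomial p (f i)) (S : Set (Fin (n + 1) → k))
    (hS : ∀ ζ ∈ S, ∑ i, (f i).eval (ζ i) = 0)
    (hdvd : ∀ G : MvPolynomial (Fin (n + 1)) k, (∀ ζ ∈ S, eval ζ G = 0) →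
      ∑ i, Polynomial.aeval (X i : MvPolynomial (Fin (n + 1)) k) (f i) ∣ G) :
    ∃ i, (f i).coeff 1 ≠ 0 := by
  by_contra! hcon
  have hp : p.Prime := Fact.out
  let M := AlgebraicClosure k
  have : CharP M p := charP_of_injective_algebraMap (algebraMap k M).injective p
  have hexp : ∀ i, Polynomial.expand k p (Polynomial.contract p (f i)) = f i := fun i => by
    ext m
    rw [Polynomial.coeff_expand hp.pos]
    split_ifs with h
    · rw [Polynomial.coeff_contract hp.ne_zero, Nat.div_mul_cancel h]
    · by_contra hm
      obtain ⟨j, rfl⟩ := (hf i).exists_of_coeff_ne_zero (Ne.symm hm)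
      rcases j with _ | j
      · exact hm (by rw [pow_zero, hcon i])
      · exact h (dvd_pow_self p (Nat.succ_ne_zero j))
  -- If all exponents are divisible by `p`, each `fᵢ` is the `p`-th power of some `gᵢ` over the
  -- perfect field `M`. Then `∑ gᵢ(xᵢ)` still vanishes on `S` and has smaller degree, but its
  -- coefficients lie in `M`.
  let g : Fin (n + 1) → M[X] := fun i =>
    ((Polynomial.contract p (f i)).map (algebraMap k M)).map
      ((frobeniusEquiv M p).symm : M →+* M)
  have hg : ∀ i, (g i) ^ p = (f i).map (algebraMap k M) := fun i => by
    rw [← Polynomial.map_frobenius_expand (p := p), ← Polynomial.map_expand, Polynomial.map_map,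
      ← Polynomial.map_expand, hexp]
    have : (frobenius M p).comp ((frobeniusEquiv M p).symm : M →+* M) = RingHom.id M := by
      ext x
      simp
    rw [this, Polynomial.map_id]
  have hgdeg : ∀ i, p * (g i).natDegree = (f i).natDegree := fun i => by
    rw [← Polynomial.natDegree_pow, hg, Polynomial.natDegree_map]
  have hg0 : ∀ i, (g i).coeff 0 = 0 := fun i => by
    have : (f i).coeff 0 = 0 := (hf i).coeff_zero_eq_zero hp.ne_zero
    simp [g, Polynomial.coeff_contract hp.ne_zero, this]
  have hgS : ∀ ζ ∈ S, ∑ i, (g i).eval (algebraMap k M (ζ i)) = 0 := fun ζ hζ => by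
    have h1 : (∑ i, (g i).eval (algebraMap k M (ζ i))) ^ p = 0 := by
      rw [sum_pow_char]
      simp_rw [← Polynomial.eval_pow, hg, Polynomial.eval_map_algebraMap,
        Polynomial.aeval_algebraMap_apply]
      rw [← map_sum]
      have := hS ζ hζ
      simp only [Polynomial.coe_aeval_eq_eval]
      rw [this, map_zero]
    exact (pow_eq_zero_iff hp.ne_zero).1 h1
  have hgne : g 0 ≠ 0 := fun h => by
    have := hgdeg 0
    rw [h, natDegree_zero, mul_zero] at this
    exact hf0 this.symm
  -- A `k`-linear functional on `M` brings the coefficients back to `k`. Vanishing on `S` survives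
  -- because the points of `S` have coordinates in `k`, and the result is nonzero if the functional
  -- does not kill the leading coefficient of `g₀`.
  obtain ⟨lam, hlam⟩ := Module.Projective.exists_dual_ne_zero k
    (Polynomial.leadingCoeff_ne_zero.2 hgne)
  let r : Fin (n + 1) → k[X] := fun i =>
    ∑ m ∈ Finset.range ((g i).natDegree + 1), Polynomial.C (lam ((g i).coeff m)) * Polynomial.X ^ m
  have hrcoeff : ∀ i m, (r i).coeff m = lam ((g i).coeff m) := fun i m => by
    simp only [r, Polynomial.finsetSum_coeff, Polynomial.coeff_C_mul_X_pow]
    rw [Finset.sum_ite_eq]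
    split_ifs with h
    · rfl
    · rw [Polynomial.coeff_eq_zero_of_natDegree_lt (by simpa using h), map_zero]
  have hreval : ∀ i x, (r i).eval x = lam ((g i).eval (algebraMap k M x)) := fun i x => by
    simp only [r]
    rw [Polynomial.eval_eq_sum_range (p := g i), map_sum, Polynomial.eval_finsetSum]
    refine Finset.sum_congr rfl fun m _ => ?_
    rw [← map_pow, mul_comm _ (algebraMap k M (x ^ m)), ← Algebra.smul_def, map_smul, smul_eq_mul,
      Polynomial.eval_mul, Polynomial.eval_C, Polynomial.eval_pow, Polynomial.eval_X, mul_comm]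
  have hrdeg : (r 0).natDegree ≤ (g 0).natDegree :=
    Polynomial.natDegree_le_iff_coeff_eq_zero.2 fun m hm => by
      rw [hrcoeff, Polynomial.coeff_eq_zero_of_natDegree_lt hm, map_zero]
  have hgd : (g 0).natDegree < (f 0).natDegree := by
    rw [← hgdeg 0] at hf0 ⊢
    have : (g 0).natDegree ≠ 0 := fun h => hf0 (by rw [h, mul_zero])
    have := hp.two_le
    have := Nat.pos_of_ne_zero ‹(g 0).natDegree ≠ 0›
    nlinarith
  have h := sum_aeval_X_eq_zero_of_dvd f r
    (Polynomial.degree_lt_degree (hrdeg.trans_lt hgd)) hf0 (hdvd _ fun ζ hζ => by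
      rw [map_sum]
      have : ∀ i, eval ζ (Polynomial.aeval (X i : MvPolynomial (Fin (n + 1)) k) (r i)) =
          lam ((g i).eval (algebraMap k M (ζ i))) := fun i => by
        rw [← hreval, ← MvPolynomial.aeval_eq_eval, ← Polynomial.aeval_algHom_apply, aeval_X,
          Polynomial.coe_aeval_eq_eval]
      simp_rw [this]
      rw [← map_sum, hgS ζ hζ, map_zero])
  have h0 := eq_zero_of_sum_aeval_X_eq_zero r
    (fun i => by rw [hrcoeff, hg0, map_zero]) h 0
  apply hlam
  rw [Polynomial.leadingCoeff, ← hrcoeff, h0, Polynomial.coeff_zero]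

end MvPolynomial

/-! ### Invariant prime ideals contain linear forms -/

namespace DrinfeldModule

variable {𝔽 K : Type*} [Field 𝔽] [Fintype 𝔽] [Field K] [Algebra 𝔽[X] K]
  (φ : DrinfeldModule 𝔽 K) {E : Type*} [Field E] [Algebra K E] {σ : Type*}

/-- Substitution of `φ_a(xᵢ)` for `xᵢ` in a polynomial. -/
noncomputable def pullback (a : 𝔽[X]) : MvPolynomial σ E →ₐ[E] MvPolynomial σ E :=
  MvPolynomial.aeval fun i => aeval (MvPolynomial.X i : MvPolynomial σ E) (φ.poly E a)

theorem aeval_poly {E' : Type*} [Field E'] [Algebra K E'] [Algebra E E'] [IsScalarTower K E E']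
    (a : 𝔽[X]) (x : E') : aeval x (φ.poly E a) = φ.act a x := by
  rw [poly, aeval_map_algebraMap, act]

theorem aeval_pullback {E' : Type*} [Field E'] [Algebra K E'] [Algebra E E'] [IsScalarTower K E E']
    (a : 𝔽[X]) (x : σ → E') (F : MvPolynomial σ E) :
    MvPolynomial.aeval x (φ.pullback a F) = MvPolynomial.aeval (fun i => φ.act a (x i)) F := by
  rw [pullback, ← AlgHom.comp_apply]
  congr 1
  refine MvPolynomial.algHom_ext fun i => ?_
  rw [AlgHom.comp_apply, MvPolynomial.aeval_X, MvPolynomial.aeval_X, ← aeval_algHom_apply,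
    MvPolynomial.aeval_X, aeval_poly]

theorem eval_pullback (a : 𝔽[X]) (x : σ → E) (F : MvPolynomial σ E) :
    MvPolynomial.eval x (φ.pullback a F) = MvPolynomial.eval (fun i => φ.act a (x i)) F := by
  rw [← MvPolynomial.aeval_eq_eval, aeval_pullback]; rfl

/-- The polynomial `∑ φ_{bᵢ}(xᵢ)`. -/
noncomputable def linearForm (E : Type*) [Field E] [Algebra K E] [Fintype σ] (b : σ → 𝔽[X]) :
    MvPolynomial σ E :=
  ∑ i, aeval (MvPolynomial.X i : MvPolynomial σ E) (φ.poly E (b i))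

theorem aeval_linearForm {E' : Type*} [Field E'] [Algebra K E'] [Algebra E E']
    [IsScalarTower K E E'] [Fintype σ] (b : σ → 𝔽[X]) (x : σ → E') :
    MvPolynomial.aeval x (φ.linearForm E b) = ∑ i, φ.act (b i) (x i) := by
  rw [linearForm, map_sum]
  refine Finset.sum_congr rfl fun i _ => ?_
  rw [← aeval_algHom_apply, MvPolynomial.aeval_X, aeval_poly]

/-- Take `T = ker φ_a` and `G` the pullback of `F` by `φ_a`. Then `G` is invariant under `T ^ (n +
1)` and divisible by `F`, its degree is at most `deg F * deg φ_a`, and `deg φ_a = #T` is unbounded.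
Surjectivity of `φ_a` on points gives `G ≠ 0`. -/
theorem hasManyTranslates [IsSepClosed E] (hi : Function.Injective (algebraMap 𝔽[X] K)) {n : ℕ}
    {F : MvPolynomial (Fin (n + 1)) E} (hF : F ≠ 0) (hinv : ∀ a, F ∣ φ.pullback a F) :
    MvPolynomial.HasManyTranslates F := by
  classical
  have := infinite_of_algebra 𝔽 K E hi
  intro B
  obtain ⟨a, ha, hB⟩ := φ.exists_le_natDegree_poly E B
  refine ⟨φ.ker E a, (φ.poly E a).roots.toFinset, φ.pullback a F, ?_, ?_, ?_, ?_, ?_⟩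
  · ext x
    rw [Finset.mem_coe, Multiset.mem_toFinset, φ.mem_roots_poly E hi ha]
    rfl
  · rwa [φ.card_roots_poly E hi ha]
  · intro h
    apply hF
    refine MvPolynomial.funext fun y => ?_
    choose x hx using fun i => φ.act_surjective E hi ha (y i)
    have := congrArg (MvPolynomial.eval x) h
    rw [eval_pullback] at this
    simpa only [hx, map_zero] using this
  · rw [φ.card_roots_poly E hi ha]
    refine MvPolynomial.totalDegree_aeval_le (fun i => ?_) F
    rw [aeval_eq_sum_range]
    refine MvPolynomial.totalDegree_finsetSum_le fun m hm => ?_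
    refine (MvPolynomial.totalDegree_smul_le _ _).trans ?_
    rw [MvPolynomial.totalDegree_X_pow]
    exact Nat.lt_succ_iff.1 (Finset.mem_range.1 hm)
  · intro ζ hζ
    have h1 : MvPolynomial.translate ζ (φ.pullback a F) = φ.pullback a F := by
      refine MvPolynomial.funext fun x => ?_
      rw [MvPolynomial.eval_translate, eval_pullback, eval_pullback]
      congr 2
      ext i
      have : φ.act a (ζ i) = 0 := hζ i
      rw [Pi.add_apply, act_add_right, this, add_zero]
    rw [← h1]
    exact map_dvd (MvPolynomial.translate ζ) (hinv a)

/-- A common left quotient of the polynomials `fᵢ ∘ φ_a` and `fᵢ`. -/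
theorem exists_comp_poly_eq (p : ℕ) [Fact p.Prime] [CharP 𝔽 p] [CharP E p] [Infinite E] {n : ℕ}
    (f : Fin (n + 1) → E[X]) (hf : ∀ i, IsTauPolynomial p (f i)) (hf0 : f 0 ≠ 0) (a : 𝔽[X])
    (hdvd : ∑ i, aeval (MvPolynomial.X i : MvPolynomial (Fin (n + 1)) E) (f i) ∣
      φ.pullback a (∑ i, aeval (MvPolynomial.X i : MvPolynomial (Fin (n + 1)) E) (f i))) :
    ∃ h : E[X], IsTauPolynomial p h ∧ ∀ i, (f i).comp (φ.poly E a) = h.comp (f i) := by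
  have hp0 : p ≠ 0 := (Fact.out : p.Prime).ne_zero
  have hφ := φ.isTauPolynomial_char E p a
  -- The quotient for the index `0` serves for all indices: `F` divides both its pullback and
  -- `h(F)`, and their difference has small degree in the variable `0`, so it is zero.
  obtain ⟨h, r, hh, hr, he, hd⟩ := ((hf 0).comp hφ).exists_comp_add (hf 0) hf0
  refine ⟨h, hh, ?_⟩
  have hnd : (f 0).natDegree ≠ 0 := by
    obtain ⟨i, hi⟩ := (hf 0).exists_natDegree_eq hf0
    rw [hi]
    exact pow_ne_zero _ hp0
  have hpull : φ.pullback a (∑ i, aeval (MvPolynomial.X i : MvPolynomial (Fin (n + 1)) E) (f i)) =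
      ∑ i, aeval (MvPolynomial.X i : MvPolynomial (Fin (n + 1)) E) ((f i).comp (φ.poly E a)) := by
    rw [map_sum]
    refine Finset.sum_congr rfl fun i _ => ?_
    rw [← aeval_algHom_apply, pullback, MvPolynomial.aeval_X, aeval_comp]
  have hcomp : aeval (∑ i, aeval (MvPolynomial.X i : MvPolynomial (Fin (n + 1)) E) (f i)) h =
      ∑ i, aeval (MvPolynomial.X i : MvPolynomial (Fin (n + 1)) E) (h.comp (f i)) := by
    rw [hh.aeval_sum]
    exact Finset.sum_congr rfl fun i _ => (aeval_comp _).symm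
  have hdvd2 : ∑ i, aeval (MvPolynomial.X i : MvPolynomial (Fin (n + 1)) E) (f i) ∣
      aeval (∑ i, aeval (MvPolynomial.X i : MvPolynomial (Fin (n + 1)) E) (f i)) h := by
    obtain ⟨h', rfl⟩ := X_dvd_iff.2 (hh.coeff_zero_eq_zero hp0)
    rw [map_mul, aeval_X]
    exact dvd_mul_right _ _
  rw [hpull] at hdvd
  rw [hcomp] at hdvd2
  have hdvd3 := dvd_sub hdvd hdvd2
  rw [← Finset.sum_sub_distrib] at hdvd3
  simp_rw [← map_sub] at hdvd3
  have hz := MvPolynomial.sum_aeval_X_eq_zero_of_dvd f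
    (fun i => (f i).comp (φ.poly E a) - h.comp (f i)) (by simp only [he]; simpa using hd) hnd hdvd3
  intro i
  have := MvPolynomial.eq_zero_of_sum_aeval_X_eq_zero _
    (fun i => (((hf i).comp hφ).sub (hh.comp (hf i))).coeff_zero_eq_zero hp0) hz i
  exact sub_eq_zero.1 this

/-- The root set of `f` is finite and stable under `φ`, so by pigeonhole every root is torsion and
one `φ_B` kills them all. Since `f` is separable it divides `φ_B` as a polynomial; it then divides
the remainder of right division by `f`, which must be zero. -/
theorem exists_poly_eq_comp (p : ℕ) [Fact p.Prime] [CharP 𝔽 p] [CharP E p] [IsSepClosed E]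
    (hi : Function.Injective (algebraMap 𝔽[X] K)) (f : E[X]) (hf : IsTauPolynomial p f)
    (hf1 : f.coeff 1 ≠ 0) (h : 𝔽[X] → E[X]) (hh : ∀ a, IsTauPolynomial p (h a))
    (hcomp : ∀ a, f.comp (φ.poly E a) = (h a).comp f) :
    ∃ (b : 𝔽[X]) (g : E[X]), b ≠ 0 ∧ IsTauPolynomial p g ∧ φ.poly E b = g.comp f := by
  classical
  have hp0 : p ≠ 0 := (Fact.out : p.Prime).ne_zero
  have hf0 : f ≠ 0 := fun h => hf1 (by rw [h, coeff_zero])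
  have htors : ∀ x ∈ f.roots, ∃ b : 𝔽[X], b ≠ 0 ∧ φ.act b x = 0 := by
    intro x hx
    have hmaps : ∀ a, φ.act a x ∈ f.roots.toFinset := fun a => by
      rw [Multiset.mem_toFinset, mem_roots hf0, IsRoot.def, act_eq_eval_poly, ← eval_comp, hcomp,
        eval_comp, (mem_roots hf0).1 hx, ← coeff_zero_eq_eval_zero,
        (hh a).coeff_zero_eq_zero hp0]
    have : ¬ Function.Injective fun a => (⟨φ.act a x, hmaps a⟩ : f.roots.toFinset) :=
      not_injective_infinite_finite _
    simp only [Function.Injective, not_forall] at this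
    obtain ⟨a, a', haa, hne⟩ := this
    refine ⟨a - a', sub_ne_zero.2 hne, ?_⟩
    rw [act_sub_left, sub_eq_zero]
    exact congrArg Subtype.val haa
  choose! b hb0 hb using htors
  have hfsep : f.Separable := by simpa using hf.separable_add_C hf1 0
  set B := ∏ x ∈ f.roots.toFinset, b x with hB
  have hB0 : B ≠ 0 := Finset.prod_ne_zero_iff.2 fun x hx => hb0 x (Multiset.mem_toFinset.1 hx)
  have hdvd : f ∣ φ.poly E B := by
    refine (IsSepClosed.splits_of_separable f hfsep).dvd_of_roots_le_roots hf0 ?_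
    rw [Multiset.le_iff_subset (nodup_roots hfsep)]
    intro x hx
    rw [φ.mem_roots_poly E hi hB0, hB,
      ← Finset.prod_erase_mul _ _ (Multiset.mem_toFinset.2 hx), act_mul, hb x hx, act_zero_right]
  obtain ⟨g, r, hg, hr, he, hd⟩ := (φ.isTauPolynomial_char E p B).exists_comp_add hf hf0
  refine ⟨B, g, hB0, hg, ?_⟩
  have hfg : f ∣ g.comp f := by
    obtain ⟨g', rfl⟩ := X_dvd_iff.2 (hg.coeff_zero_eq_zero hp0)
    rw [mul_comp, X_comp]
    exact dvd_mul_right _ _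
  have hfr : f ∣ r := by
    have := dvd_sub hdvd hfg
    rwa [he, add_sub_cancel_left] at this
  rw [he, eq_zero_of_dvd_of_degree_lt hfr hd, add_zero]

/-- An irreducible hypersurface that is invariant under `φ` and does not come from fewer variables
lies in the zero set of a linear form. -/
theorem exists_dvd_linearForm [IsSepClosed E] (hi : Function.Injective (algebraMap 𝔽[X] K))
    (hEnd : ∀ f : E[X], IsTauPolynomial (Fintype.card 𝔽) f →
      (∀ a, f.comp (φ.poly E a) = (φ.poly E a).comp f) → ∃ a, f = φ.poly E a) {n : ℕ}
    {F : MvPolynomial (Fin (n + 1)) E} (hF : Prime F) (h0 : MvPolynomial.eval 0 F = 0)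
    (hsucc : ∀ R : MvPolynomial (Fin n) E, F ∣ MvPolynomial.rename Fin.succ R → R = 0)
    (hinv : ∀ a, F ∣ φ.pullback a F) :
    ∃ b : Fin (n + 1) → 𝔽[X], b ≠ 0 ∧ F ∣ φ.linearForm E b := by
  obtain ⟨p, -, _, _, -⟩ := exists_prime_card_eq 𝔽
  have := charP_of_algebra 𝔽 K E p
  have := infinite_of_algebra 𝔽 K E hi
  have hp : p.Prime := Fact.out
  have hp0 : p ≠ 0 := hp.ne_zero
  have hmany := φ.hasManyTranslates hi hF.ne_zero hinv
  have hstab := fun G => MvPolynomial.dvd_of_forall_stabilizer p (G := G) hF h0 hsucc hmany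
  obtain ⟨f, hf, rfl⟩ := MvPolynomial.exists_eq_sum_aeval_X p
    (MvPolynomial.eval_add_of_forall_stabilizer p hF hstab)
  have hevalF : ∀ x : Fin (n + 1) → E, MvPolynomial.eval x
      (∑ i, aeval (MvPolynomial.X i : MvPolynomial (Fin (n + 1)) E) (f i)) =
      ∑ i, (f i).eval (x i) := fun x => by
    rw [← MvPolynomial.aeval_eq_eval, map_sum]
    refine Finset.sum_congr rfl fun i _ => ?_
    rw [← aeval_algHom_apply, MvPolynomial.aeval_X, coe_aeval_eq_eval]
  have hf0 : f 0 ≠ 0 := fun h => by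
    have h1 : ∑ i, aeval (MvPolynomial.X i : MvPolynomial (Fin (n + 1)) E) (f i) =
        MvPolynomial.rename Fin.succ
          (∑ i : Fin n, aeval (MvPolynomial.X i : MvPolynomial (Fin n) E) (f i.succ)) := by
      rw [Fin.sum_univ_succ, h, map_zero, zero_add, map_sum]
      refine Finset.sum_congr rfl fun i _ => ?_
      rw [← aeval_algHom_apply, MvPolynomial.rename_X]
    have h2 := hsucc _ (dvd_of_eq h1)
    rw [h2, map_zero] at h1
    exact hF.ne_zero h1
  have hnd : (f 0).natDegree ≠ 0 := by
    obtain ⟨i, hi⟩ := (hf 0).exists_natDegree_eq hf0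
    rw [hi]
    exact pow_ne_zero _ hp0
  choose h hh hcomp using fun a => φ.exists_comp_poly_eq p f hf hf0 a (hinv a)
  -- Lowest-order terms of `fᵢ ∘ φ_X = h_X ∘ fᵢ`. The right side does not depend on `i`, and `i(X)`
  -- is not a root of unity, so all nonzero `fᵢ` have the same trailing degree.
  have htrail : ∀ i, f i ≠ 0 →
      (algebraMap K E (algebraMap 𝔽[X] K X)) ^ (f i).natTrailingDegree = (h X).coeff 1 := by
    intro i hne
    have hlt : ∀ m < (f i).natTrailingDegree, (f i).coeff m = 0 := fun m hm =>
      coeff_eq_zero_of_lt_natTrailingDegree hm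
    have hN : (f i).natTrailingDegree ≠ 0 := fun h =>
      (trailingCoeff_nonzero_iff_nonzero.2 hne : (f i).trailingCoeff ≠ 0)
        (by rw [trailingCoeff, h, (hf i).coeff_zero_eq_zero hp0])
    have h1 := congrArg (fun P => coeff P (f i).natTrailingDegree) (hcomp X i)
    beta_reduce at h1
    rw [coeff_comp_of_forall_lt hlt (φ.coeff_zero_poly E X),
      coeff_comp_of_forall_lt' hN hlt ((hh X).coeff_zero_eq_zero hp0), coeff_one_poly,
      mul_comm] at h1
    exact mul_right_cancel₀ (trailingCoeff_nonzero_iff_nonzero.2 hne) h1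
  -- Since `F` generates the vanishing ideal of its stabilizer, some `fᵢ` has a linear term. The
  -- common trailing degree is therefore `1`, and `f₀` is separable.
  obtain ⟨i₁, hi₁⟩ := MvPolynomial.exists_coeff_ne_zero_of_forall_dvd p f hnd hf
    {ζ | MvPolynomial.translate ζ
      (∑ i, aeval (MvPolynomial.X i : MvPolynomial (Fin (n + 1)) E) (f i)) =
      ∑ i, aeval (MvPolynomial.X i : MvPolynomial (Fin (n + 1)) E) (f i)}
    (fun ζ hζ => by
      rw [← hevalF, ← h0]
      conv_rhs => rw [← (show _ = _ from hζ), MvPolynomial.eval_translate, zero_add])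
    (fun G hG => hstab G hG)
  have hfi₁ : f i₁ ≠ 0 := fun h => hi₁ (by rw [h, coeff_zero])
  have hN1 : (f i₁).natTrailingDegree = 1 := by
    have h1 := natTrailingDegree_le_of_ne_zero hi₁
    have h2 : (f i₁).natTrailingDegree ≠ 0 := fun h =>
      (trailingCoeff_nonzero_iff_nonzero.2 hfi₁ : (f i₁).trailingCoeff ≠ 0)
        (by rw [trailingCoeff, h, (hf i₁).coeff_zero_eq_zero hp0])
    omega
  have hN0 : (f 0).natTrailingDegree = 1 := by
    have h1 := (htrail 0 hf0).trans (htrail i₁ hfi₁).symm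
    rw [hN1, ← map_pow, ← map_pow, ← map_pow, ← map_pow] at h1
    have h2 := hi ((algebraMap K E).injective h1)
    have := congrArg natDegree h2
    rwa [natDegree_X_pow, natDegree_X_pow] at this
  have hf01 : (f 0).coeff 1 ≠ 0 := by
    have h1 : (f 0).coeff 1 = (f 0).trailingCoeff := by rw [trailingCoeff, hN0]
    rw [h1]
    exact trailingCoeff_nonzero_iff_nonzero.2 hf0
  obtain ⟨b, g, hb0, hg, hbg⟩ := φ.exists_poly_eq_comp p hi (f 0) (hf 0) hf01 h hh
    fun a => hcomp a 0
  -- Cancel `f₀` on the right in `g ∘ h_a ∘ f₀ = g ∘ f₀ ∘ φ_a = φ_b ∘ φ_a = φ_a ∘ φ_b = φ_a ∘ g ∘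
  -- f₀`.
  have hgh : ∀ a, g.comp (h a) = (φ.poly E a).comp g := fun a => by
    apply comp_right_cancel hnd
    rw [comp_assoc, ← hcomp a 0, ← comp_assoc, ← hbg, comp_assoc, ← hbg, ← poly_mul, ← poly_mul,
      mul_comm]
  have hcomm : ∀ i a, (g.comp (f i)).comp (φ.poly E a) = (φ.poly E a).comp (g.comp (f i)) :=
    fun i a => by rw [comp_assoc, hcomp a i, ← comp_assoc, hgh, comp_assoc]
  have htau : ∀ i, IsTauPolynomial (Fintype.card 𝔽) (g.comp (f i)) := fun i =>
    (hg.comp (hf i)).of_comp_C_mul_X ((algebraMap K E).comp ((algebraMap 𝔽[X] K).comp C))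
      fun c => by
        have := hcomm i (C c)
        rwa [poly_C] at this
  choose B hB using fun i => hEnd _ (htau i) (hcomm i)
  refine ⟨B, fun hB0 => ?_, ?_⟩
  · have := hB 0
    rw [← hbg, hB0, Pi.zero_apply, poly_zero] at this
    exact φ.poly_ne_zero E hi hb0 this
  · have h1 : φ.linearForm E B =
        aeval (∑ i, aeval (MvPolynomial.X i : MvPolynomial (Fin (n + 1)) E) (f i)) g := by
      rw [hg.aeval_sum, linearForm]
      refine Finset.sum_congr rfl fun i _ => ?_
      rw [← hB i, aeval_comp]
    rw [h1]
    obtain ⟨g', rfl⟩ := X_dvd_iff.2 (hg.coeff_zero_eq_zero hp0)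
    rw [map_mul, aeval_X]
    exact dvd_mul_right _ _

/-- A prime ideal that is invariant under `φ` and defines a proper closed subset through the origin
contains a nonzero linear form. -/
theorem exists_linearForm_mem [IsSepClosed E] (hi : Function.Injective (algebraMap 𝔽[X] K))
    (hEnd : ∀ f : E[X], IsTauPolynomial (Fintype.card 𝔽) f →
      (∀ a, f.comp (φ.poly E a) = (φ.poly E a).comp f) → ∃ a, f = φ.poly E a) {g : ℕ}
    (P : Ideal (MvPolynomial (Fin g) E)) (hP : P.IsPrime) (hne : P ≠ ⊥)
    (h0 : ∀ f ∈ P, MvPolynomial.eval 0 f = 0) (hinv : ∀ a, ∀ f ∈ P, φ.pullback a f ∈ P) :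
    ∃ b : Fin g → 𝔽[X], b ≠ 0 ∧ φ.linearForm E b ∈ P := by
  induction g with
  | zero =>
    exfalso
    obtain ⟨f, hf, hf0⟩ := Submodule.exists_mem_ne_zero_of_ne_bot hne
    apply hf0
    rw [MvPolynomial.eq_C_of_isEmpty f] at hf ⊢
    have := h0 _ hf
    rw [MvPolynomial.eval_C] at this
    rw [this, MvPolynomial.C_0]
  | succ n ih =>
    -- Either `P` has no nonzero element free of the variable `0`, and elimination shows that any
    -- prime element of `P` generates it; or `P` contracts to a nonzero prime in fewer variables.
    by_cases hcon : P.comap (MvPolynomial.rename (R := E) (Fin.succ : Fin n → Fin (n + 1))) = ⊥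
    · obtain ⟨F, hFP, hF⟩ := hP.exists_mem_prime_of_ne_bot hne
      have hmem : ∀ R : MvPolynomial (Fin n) E, MvPolynomial.rename Fin.succ R ∈ P → R = 0 :=
        fun R hR => by
          have : R ∈ P.comap (MvPolynomial.rename (R := E) (Fin.succ : Fin n → Fin (n + 1))) := hR
          rwa [hcon, Ideal.mem_bot] at this
      have hsucc : ∀ R : MvPolynomial (Fin n) E, F ∣ MvPolynomial.rename Fin.succ R → R = 0 :=
        fun R hR => hmem R (P.mem_of_dvd hR hFP)
      have hprinc : ∀ G ∈ P, F ∣ G := fun G hG => by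
        by_contra hdvd
        obtain ⟨R, hR0, a, b, hR⟩ := MvPolynomial.exists_rename_succ_eq_of_not_dvd hF hsucc hdvd
        exact hR0 (hmem R (hR ▸ P.add_mem (P.mul_mem_left _ hFP) (P.mul_mem_left _ hG)))
      obtain ⟨b, hb, hdvd⟩ := φ.exists_dvd_linearForm hi hEnd hF (h0 F hFP) hsucc
        fun a => hprinc _ (hinv a F hFP)
      exact ⟨b, hb, P.mem_of_dvd hdvd hFP⟩
    · obtain ⟨b, hb, hmem⟩ := ih _ (hP.comap _) hcon
        (fun f hf => by
          have := h0 _ hf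
          rw [MvPolynomial.eval_rename] at this
          exact this)
        (fun a f hf => by
          have := hinv a _ hf
          rw [Ideal.mem_comap]
          convert! this using 1
          rw [← AlgHom.comp_apply, ← AlgHom.comp_apply]
          congr 1
          refine MvPolynomial.algHom_ext fun i => ?_
          simp only [AlgHom.comp_apply, pullback, MvPolynomial.aeval_X, MvPolynomial.rename_X,
            ← aeval_algHom_apply])
      refine ⟨Fin.cons 0 b, fun h => hb ?_, ?_⟩
      · ext1 i
        simpa using congrFun h i.succ
      · rw [Ideal.mem_comap, linearForm, map_sum] at hmem
        rw [linearForm, Fin.sum_univ_succ, Fin.cons_zero, poly_zero, map_zero, zero_add]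
        simp only [Fin.cons_succ]
        convert! hmem using 2 with i
        rw [← aeval_algHom_apply, MvPolynomial.rename_X]

end DrinfeldModule

/-! ### Completion of a primitive vector to an invertible matrix -/

/-- Let `d` be a generator of the ideal of the `bᵢ` and `l = b / d`. Bézout gives `u` with `l u =
1`, so the module splits as `A u ⊕ ker l`, with `ker l` free of rank `n`. In a basis adapted to this
splitting `l` is the first coordinate, so it is the first row of the inverse base change. -/
theorem exists_unimodular_matrix {A : Type*} [CommRing A] [IsDomain A] [IsPrincipalIdealRing A]
    {n : ℕ} (b : Fin (n + 1) → A) (hb : b ≠ 0) :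
    ∃ (M M' : Matrix (Fin (n + 1)) (Fin (n + 1)) A) (d : A), d ≠ 0 ∧ M * M' = 1 ∧ M' * M = 1 ∧
      ∀ i, b i = d * M 0 i := by
  obtain ⟨d, hd⟩ := IsPrincipalIdealRing.principal (Ideal.span (Set.range b))
  have hd' : Ideal.span (Set.range b) = Ideal.span {d} := hd
  have hdvd : ∀ i, d ∣ b i := fun i => by
    rw [← Ideal.mem_span_singleton, ← hd']
    exact Ideal.subset_span ⟨i, rfl⟩
  have hd0 : d ≠ 0 := by
    rintro rfl
    exact hb (funext fun i => zero_dvd_iff.1 (hdvd i))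
  choose l hl using hdvd
  obtain ⟨u, hu⟩ := Ideal.mem_span_range_iff_exists_fun.1
    (hd' ▸ Ideal.mem_span_singleton_self d : d ∈ Ideal.span (Set.range b))
  let f : (Fin (n + 1) → A) →ₗ[A] A := ∑ i, l i • LinearMap.proj i
  have hf : ∀ x, f x = ∑ i, l i * x i := fun x => by simp [f]
  have hfu : f u = 1 := by
    rw [hf]
    refine mul_left_cancel₀ hd0 ?_
    rw [mul_one, Finset.mul_sum]
    conv_rhs => rw [← hu]
    exact Finset.sum_congr rfl fun i _ => by rw [hl i]; ring
  have hrank : Module.finrank A (LinearMap.ker f) = n := by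
    have h1 := Submodule.finrank_quotient_add_finrank (LinearMap.ker f)
    have h2 : Function.Surjective f := fun a =>
      ⟨a • u, by rw [map_smul, hfu, smul_eq_mul, mul_one]⟩
    rw [(f.quotKerEquivOfSurjective h2).finrank_eq, Module.finrank_self,
      Module.finrank_fin_fun] at h1
    omega
  let e := Module.finBasisOfFinrankEq A (LinearMap.ker f) hrank
  let g : (Fin (n + 1) → A) →ₗ[A] (Fin (n + 1) → A) :=
    (LinearMap.proj 0).smulRight u + (LinearMap.ker f).subtype ∘ₗ
      (e.equivFun.symm : (Fin n → A) →ₗ[A] LinearMap.ker f) ∘ₗ LinearMap.funLeft A A Fin.succ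
  have hg : ∀ y, g y = y 0 • u + (e.equivFun.symm (fun i => y i.succ) : LinearMap.ker f) :=
    fun y => rfl
  have hfg : ∀ y, f (g y) = y 0 := fun y => by
    rw [hg, map_add, map_smul, hfu, LinearMap.mem_ker.1 (Subtype.coe_prop _), add_zero, smul_eq_mul,
      mul_one]
  have hbij : Function.Bijective g := by
    constructor
    · rw [injective_iff_map_eq_zero]
      intro y hy
      have h0 : y 0 = 0 := by rw [← hfg y, hy, map_zero]
      rw [hg, h0, zero_smul, zero_add, ZeroMemClass.coe_eq_zero,
        LinearEquiv.map_eq_zero_iff] at hy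
      ext i
      refine Fin.cases h0 (fun j => congrFun hy j) i
    · intro x
      have hx : x - f x • u ∈ LinearMap.ker f := by
        rw [LinearMap.mem_ker, map_sub, map_smul, hfu, smul_eq_mul, mul_one, sub_self]
      refine ⟨Fin.cons (f x) (e.equivFun ⟨_, hx⟩), ?_⟩
      rw [hg]
      simp only [Fin.cons_zero, Fin.cons_succ]
      rw [LinearEquiv.symm_apply_apply]
      simp
  let G := LinearEquiv.ofBijective g hbij
  refine ⟨LinearMap.toMatrix' G.symm.toLinearMap, LinearMap.toMatrix' G.toLinearMap, d, hd0,
    ?_, ?_, fun i => ?_⟩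
  · rw [← LinearMap.toMatrix'_comp]
    simp
  · rw [← LinearMap.toMatrix'_comp]
    simp
  · rw [LinearMap.toMatrix'_apply]
    have : g (G.symm (fun j => if j = i then 1 else 0)) = fun j => if j = i then 1 else 0 :=
      G.apply_symm_apply _
    have h2 : (Pi.single i 1 : Fin (n + 1) → A) = fun j => if j = i then 1 else 0 := by
      ext j
      rw [Pi.single_apply]
    have h3 := hfg (G.symm fun j => if j = i then 1 else 0)
    rw [LinearEquiv.coe_coe, h2, ← h3, this, hf]
    simpa using hl i

/-! ### The Zariski topology defined over `K^sep`, on points in `L` -/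

section Zariski

variable (K : Type*) {L : Type*} [Field K] [Field L] [Algebra K L] {g h : ℕ}

/-- The closure of a set in the `K^sep`-Zariski topology. -/
def sepZariskiClosure (S : Set (Fin g → L)) : Set (Fin g → L) :=
  MvPolynomial.zeroLocus L (MvPolynomial.vanishingIdeal (separableClosure K L) S)

/-- A set of points whose `K^sep`-Zariski closure is irreducible. -/
def IsSepIrreducible (S : Set (Fin g → L)) : Prop :=
  (MvPolynomial.vanishingIdeal (separableClosure K L) S).IsPrime

/-- A morphism of affine spaces over `K^sep`. -/
def IsSepMorphism (f : (Fin g → L) → (Fin h → L)) : Prop :=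
  ∃ m : Fin h → MvPolynomial (Fin g) (separableClosure K L),
    ∀ x j, f x j = MvPolynomial.aeval x (m j)

variable {K}

theorem mem_sepZariskiClosure {S : Set (Fin g → L)} {x : Fin g → L} :
    x ∈ sepZariskiClosure K S ↔ ∀ f : MvPolynomial (Fin g) (separableClosure K L),
      (∀ s ∈ S, MvPolynomial.aeval s f = 0) → MvPolynomial.aeval x f = 0 :=
  Iff.rfl

theorem isSepSubvariety_sepZariskiClosure (S : Set (Fin g → L)) :
    IsSepSubvariety K (sepZariskiClosure K S) :=
  ⟨_, rfl⟩

theorem subset_sepZariskiClosure (S : Set (Fin g → L)) : S ⊆ sepZariskiClosure K S :=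
  MvPolynomial.zeroLocus_vanishingIdeal_le S

theorem IsSepSubvariety.sepZariskiClosure_subset {S Z : Set (Fin g → L)} (hZ : IsSepSubvariety K Z)
    (hS : S ⊆ Z) : sepZariskiClosure K S ⊆ Z := by
  obtain ⟨I, rfl⟩ := hZ
  exact MvPolynomial.zeroLocus_anti_mono (MvPolynomial.le_zeroLocus_iff_le_vanishingIdeal.1 hS)

theorem sepZariskiClosure_mono {S T : Set (Fin g → L)} (h : S ⊆ T) :
    sepZariskiClosure K S ⊆ sepZariskiClosure K T :=
  (isSepSubvariety_sepZariskiClosure T).sepZariskiClosure_subset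
    (h.trans (subset_sepZariskiClosure T))

theorem IsSepSubvariety.sepZariskiClosure_eq {Z : Set (Fin g → L)} (hZ : IsSepSubvariety K Z) :
    sepZariskiClosure K Z = Z :=
  (hZ.sepZariskiClosure_subset subset_rfl).antisymm (subset_sepZariskiClosure Z)

theorem isSepSubvariety_setOf_aeval_eq_zero (f : MvPolynomial (Fin g) (separableClosure K L)) :
    IsSepSubvariety K {x : Fin g → L | MvPolynomial.aeval x f = 0} :=
  ⟨Ideal.span {f}, by rw [MvPolynomial.zeroLocus_span]; simp⟩

theorem IsSepSubvariety.inter {Z₁ Z₂ : Set (Fin g → L)} (h₁ : IsSepSubvariety K Z₁)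
    (h₂ : IsSepSubvariety K Z₂) : IsSepSubvariety K (Z₁ ∩ Z₂) := by
  obtain ⟨I, rfl⟩ := h₁
  obtain ⟨J, rfl⟩ := h₂
  exact ⟨I ⊔ J, (MvPolynomial.zeroLocus_vanishingIdeal_galoisConnection.l_sup).symm⟩

theorem isSepSubvariety_univ : IsSepSubvariety K (Set.univ : Set (Fin g → L)) :=
  ⟨⊥, MvPolynomial.zeroLocus_bot.symm⟩

theorem IsIrreducibleSepSubvariety.isSepIrreducible {Z : Set (Fin g → L)}
    (hZ : IsIrreducibleSepSubvariety K Z) : IsSepIrreducible K Z := by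
  obtain ⟨-, ⟨z, hz⟩, hirr⟩ := hZ
  refine ⟨fun h => ?_, fun {f₁ f₂} hf => ?_⟩
  · have : (1 : MvPolynomial (Fin g) (separableClosure K L)) ∈ MvPolynomial.vanishingIdeal _ Z := by
      rw [h]
      exact Submodule.mem_top
    simpa using this z hz
  · refine hirr _ _ (isSepSubvariety_setOf_aeval_eq_zero f₁)
      (isSepSubvariety_setOf_aeval_eq_zero f₂) fun x hx => ?_
    have := hf x hx
    rw [map_mul] at this
    exact mul_eq_zero.1 this

theorem IsSepIrreducible.nonempty {S : Set (Fin g → L)} (hS : IsSepIrreducible K S) :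
    S.Nonempty := by
  by_contra h
  rw [Set.not_nonempty_iff_eq_empty] at h
  subst h
  exact hS.ne_top MvPolynomial.vanishingIdeal_empty

theorem IsSepIrreducible.subset_or_subset {S : Set (Fin g → L)} (hS : IsSepIrreducible K S)
    {Z₁ Z₂ : Set (Fin g → L)} (h₁ : IsSepSubvariety K Z₁) (h₂ : IsSepSubvariety K Z₂)
    (h : S ⊆ Z₁ ∪ Z₂) : S ⊆ Z₁ ∨ S ⊆ Z₂ := by
  obtain ⟨I, rfl⟩ := h₁
  obtain ⟨J, rfl⟩ := h₂
  by_contra! hcon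
  obtain ⟨⟨x, hx, hxI⟩, y, hy, hyJ⟩ := Set.not_subset.1 hcon.1, Set.not_subset.1 hcon.2
  rw [MvPolynomial.mem_zeroLocus_iff] at hxI hyJ
  push Not at hxI hyJ
  obtain ⟨f₁, hf₁, hfx⟩ := hxI
  obtain ⟨f₂, hf₂, hfy⟩ := hyJ
  have hmem : f₁ * f₂ ∈ MvPolynomial.vanishingIdeal (separableClosure K L) S := fun z hz => by
    rw [map_mul]
    rcases h hz with h' | h'
    · rw [h' f₁ hf₁, zero_mul]
    · rw [h' f₂ hf₂, mul_zero]
  rcases hS.mem_or_mem hmem with h' | h'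
  · exact hfx (h' x hx)
  · exact hfy (h' y hy)

theorem IsSepIrreducible.exists_subset {S : Set (Fin g → L)} (hS : IsSepIrreducible K S)
    {ι : Type*} (s : Finset ι) (Z : ι → Set (Fin g → L)) (hZ : ∀ i, IsSepSubvariety K (Z i))
    (h : S ⊆ ⋃ i ∈ s, Z i) : ∃ i ∈ s, S ⊆ Z i := by
  by_contra! hcon
  choose! x hxS hxZ using fun i hi => Set.not_subset.1 (hcon i hi)
  have : ∀ i, ∃ f : MvPolynomial (Fin g) (separableClosure K L), i ∈ s →
      (∀ z ∈ Z i, MvPolynomial.aeval z f = 0) ∧ MvPolynomial.aeval (x i) f ≠ 0 := fun i => by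
    by_cases hi : i ∈ s
    · have h1 := hxZ i hi
      rw [← (hZ i).sepZariskiClosure_eq, mem_sepZariskiClosure] at h1
      push Not at h1
      obtain ⟨f, hf⟩ := h1
      exact ⟨f, fun _ => hf⟩
    · exact ⟨0, fun h => absurd h hi⟩
  choose f hf using this
  have hmem : ∏ i ∈ s, f i ∈ MvPolynomial.vanishingIdeal (separableClosure K L) S := fun z hz => by
    obtain ⟨i, hi, hzi⟩ := Set.mem_iUnion₂.1 (h hz)
    rw [map_prod]
    exact Finset.prod_eq_zero hi ((hf i hi).1 z hzi)
  obtain ⟨i, hi, hfi⟩ := (Ideal.IsPrime.prod_mem_iff (hp := hS)).1 hmem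
  exact (hf i hi).2 (hfi _ (hxS i hi))

theorem IsSepIrreducible.isIrreducibleSepSubvariety {S : Set (Fin g → L)}
    (hS : IsSepIrreducible K S) : IsIrreducibleSepSubvariety K (sepZariskiClosure K S) := by
  refine ⟨isSepSubvariety_sepZariskiClosure S, hS.nonempty.mono (subset_sepZariskiClosure S), ?_⟩
  intro Z₁ Z₂ h₁ h₂ h
  rcases hS.subset_or_subset h₁ h₂ ((subset_sepZariskiClosure S).trans h) with h' | h'
  · exact Or.inl (h₁.sepZariskiClosure_subset h')
  · exact Or.inr (h₂.sepZariskiClosure_subset h')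

theorem IsSepSubvariety.isIrreducibleSepSubvariety {Z : Set (Fin g → L)}
    (hZ : IsSepSubvariety K Z) (hirr : IsSepIrreducible K Z) : IsIrreducibleSepSubvariety K Z := by
  rw [← hZ.sepZariskiClosure_eq]
  exact hirr.isIrreducibleSepSubvariety

theorem isIrreducibleSepSubvariety_univ [Infinite (separableClosure K L)] :
    IsIrreducibleSepSubvariety K (Set.univ : Set (Fin g → L)) := by
  refine isSepSubvariety_univ.isIrreducibleSepSubvariety ?_
  have : MvPolynomial.vanishingIdeal (separableClosure K L) (Set.univ : Set (Fin g → L)) = ⊥ := by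
    rw [eq_bot_iff]
    intro f hf
    refine MvPolynomial.funext fun x => ?_
    apply (algebraMap (separableClosure K L) L).injective
    rw [map_zero, map_zero, ← hf _ (Set.mem_univ fun i => (x i : L)), ← MvPolynomial.aeval_eq_eval]
    exact (MvPolynomial.aeval_algebraMap_apply L x f).symm
  rw [IsSepIrreducible, this]
  exact Ideal.isPrime_bot

/-- A dense subset has the same vanishing ideal. -/
theorem IsSepIrreducible.of_subset_sepZariskiClosure {S D : Set (Fin g → L)}
    (hS : IsSepIrreducible K S) (hDS : D ⊆ S) (hSD : S ⊆ sepZariskiClosure K D) :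
    IsSepIrreducible K D := by
  have : MvPolynomial.vanishingIdeal (separableClosure K L) D =
      MvPolynomial.vanishingIdeal (separableClosure K L) S :=
    le_antisymm (fun f hf s hs => mem_sepZariskiClosure.1 (hSD hs) f hf)
      fun f hf d hd => hf d (hDS hd)
  rwa [IsSepIrreducible, this]

theorem aeval_comp_eq (m : Fin h → MvPolynomial (Fin g) (separableClosure K L))
    (x : Fin g → L) (F : MvPolynomial (Fin h) (separableClosure K L)) :
    MvPolynomial.aeval x (MvPolynomial.aeval m F) =
      MvPolynomial.aeval (fun j => MvPolynomial.aeval x (m j)) F := by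
  rw [← AlgHom.comp_apply]
  congr 1
  refine MvPolynomial.algHom_ext fun i => ?_
  rw [AlgHom.comp_apply, MvPolynomial.aeval_X, MvPolynomial.aeval_X]

theorem IsSepMorphism.exists_aeval {f : (Fin g → L) → (Fin h → L)} (hf : IsSepMorphism K f) :
    ∃ c : MvPolynomial (Fin h) (separableClosure K L) →ₐ[separableClosure K L]
      MvPolynomial (Fin g) (separableClosure K L),
      ∀ x F, MvPolynomial.aeval x (c F) = MvPolynomial.aeval (f x) F := by
  obtain ⟨m, hm⟩ := hf
  refine ⟨MvPolynomial.aeval m, fun x F => ?_⟩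
  rw [aeval_comp_eq]
  congr 2
  ext j
  rw [hm]

theorem IsSepMorphism.isSepIrreducible_image {f : (Fin g → L) → (Fin h → L)}
    (hf : IsSepMorphism K f) {S : Set (Fin g → L)} (hS : IsSepIrreducible K S) :
    IsSepIrreducible K (f '' S) := by
  obtain ⟨c, hc⟩ := hf.exists_aeval
  have : MvPolynomial.vanishingIdeal (separableClosure K L) (f '' S) =
      (MvPolynomial.vanishingIdeal (separableClosure K L) S).comap c := by
    ext F
    rw [Ideal.mem_comap, MvPolynomial.mem_vanishingIdeal_iff, MvPolynomial.mem_vanishingIdeal_iff,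
      Set.forall_mem_image]
    simp_rw [hc]
  rw [IsSepIrreducible, this]
  have := hS
  rw [IsSepIrreducible] at this
  infer_instance

theorem IsSepMorphism.image_sepZariskiClosure_subset {f : (Fin g → L) → (Fin h → L)}
    (hf : IsSepMorphism K f) (S : Set (Fin g → L)) :
    f '' sepZariskiClosure K S ⊆ sepZariskiClosure K (f '' S) := by
  obtain ⟨c, hc⟩ := hf.exists_aeval
  rintro _ ⟨x, hx, rfl⟩
  rw [mem_sepZariskiClosure]
  intro F hF
  rw [← hc]
  exact hx _ fun s hs => by rw [hc]; exact hF _ ⟨s, hs, rfl⟩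

theorem IsSepSubvariety.preimage {f : (Fin g → L) → (Fin h → L)} (hf : IsSepMorphism K f)
    {Z : Set (Fin h → L)} (hZ : IsSepSubvariety K Z) : IsSepSubvariety K (f ⁻¹' Z) := by
  have : f ⁻¹' Z = sepZariskiClosure K (f ⁻¹' Z) := by
    refine (subset_sepZariskiClosure _).antisymm fun x hx => ?_
    have h1 := hf.image_sepZariskiClosure_subset (f ⁻¹' Z) ⟨x, hx, rfl⟩
    exact hZ.sepZariskiClosure_subset (Set.image_preimage_subset f Z) h1
  rw [this]
  exact isSepSubvariety_sepZariskiClosure _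

theorem IsSepMorphism.comp {l : ℕ} {f : (Fin g → L) → (Fin h → L)} {f' : (Fin h → L) → (Fin l → L)}
    (hf' : IsSepMorphism K f') (hf : IsSepMorphism K f) : IsSepMorphism K (f' ∘ f) := by
  obtain ⟨m₁, h₁⟩ := hf'
  obtain ⟨m₂, h₂⟩ := hf
  refine ⟨fun j => MvPolynomial.aeval m₂ (m₁ j), fun x j => ?_⟩
  rw [aeval_comp_eq, Function.comp_apply, h₁]
  congr 2
  ext i
  exact h₂ x i

theorem isSepMorphism_tail : IsSepMorphism K (fun x : Fin (g + 1) → L => Fin.tail x) :=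
  ⟨fun j => MvPolynomial.X j.succ, fun x j => by rw [MvPolynomial.aeval_X]; rfl⟩

theorem isSepMorphism_cons (c : separableClosure K L) :
    IsSepMorphism K (fun x : Fin g → L => (Fin.cons (c : L) x : Fin (g + 1) → L)) := by
  refine ⟨Fin.cons (MvPolynomial.C c) fun j => MvPolynomial.X j, fun x j => ?_⟩
  refine Fin.cases ?_ (fun i => ?_) j
  · rw [Fin.cons_zero, MvPolynomial.aeval_C]
    rfl
  · rw [Fin.cons_succ, MvPolynomial.aeval_X]
    rfl

/-- Every set of points is a finite union of sets with irreducible closure. -/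
theorem exists_finset_isSepIrreducible (S : Set (Fin g → L)) :
    ∃ s : Set (Set (Fin g → L)), s.Finite ∧ (∀ T ∈ s, IsSepIrreducible K T) ∧ S = ⋃₀ s := by
  induction hI : MvPolynomial.vanishingIdeal (separableClosure K L) S using
    WellFoundedGT.induction generalizing S with
  | ind I ih =>
    subst hI
    rcases S.eq_empty_or_nonempty with rfl | ⟨x, hx⟩
    · exact ⟨∅, Set.finite_empty, by simp, by simp⟩
    by_cases hprime : IsSepIrreducible K S
    · exact ⟨{S}, Set.finite_singleton S, by simpa using hprime, by simp⟩
    have hne : MvPolynomial.vanishingIdeal (separableClosure K L) S ≠ ⊤ := fun h => by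
      have : (1 : MvPolynomial (Fin g) (separableClosure K L)) ∈
          MvPolynomial.vanishingIdeal _ S := by
        rw [h]
        exact Submodule.mem_top
      simpa using this x hx
    rw [IsSepIrreducible, Ideal.isPrime_iff] at hprime
    push Not at hprime
    obtain ⟨f₁, f₂, hf, hf₁, hf₂⟩ := hprime hne
    -- Noetherian induction: if `f₁ * f₂` vanishes on `S` but neither factor does, then `S` is the
    -- union of its zero sets for `f₁` and `f₂`, both with strictly larger vanishing ideals.
    have key : ∀ f : MvPolynomial (Fin g) (separableClosure K L),
        f ∉ MvPolynomial.vanishingIdeal (separableClosure K L) S →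
        MvPolynomial.vanishingIdeal (separableClosure K L) S <
        MvPolynomial.vanishingIdeal (separableClosure K L)
          (S ∩ {x | MvPolynomial.aeval x f = 0}) := fun f hfS =>
      lt_of_le_of_ne (MvPolynomial.vanishingIdeal_anti_mono Set.inter_subset_left)
        fun h => hfS (h ▸ fun z hz => hz.2)
    obtain ⟨s₁, h₁, h₁', e₁⟩ := ih _ (key f₁ hf₁) _ rfl
    obtain ⟨s₂, h₂, h₂', e₂⟩ := ih _ (key f₂ hf₂) _ rfl
    refine ⟨s₁ ∪ s₂, h₁.union h₂, ?_, ?_⟩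
    · rintro T (hT | hT)
      · exact h₁' T hT
      · exact h₂' T hT
    · rw [Set.sUnion_union, ← e₁, ← e₂, ← Set.inter_union_distrib_left]
      refine (Set.inter_eq_left.2 fun z hz => ?_).symm
      have := hf z hz
      rw [map_mul] at this
      exact mul_eq_zero.1 this

end Zariski

/-! ### Coordinate changes, torsion subvarieties and density of torsion -/

namespace DrinfeldModule

variable {𝔽 K : Type*} [Field 𝔽] [Fintype 𝔽] [Field K] [Algebra 𝔽[X] K]

section MatAct

variable (φ : DrinfeldModule 𝔽 K) {E : Type*} [Field E] [Algebra K E]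

theorem act_sum_left {ι : Type*} (s : Finset ι) (a : ι → 𝔽[X]) (x : E) :
    φ.act (∑ i ∈ s, a i) x = ∑ i ∈ s, φ.act (a i) x := by
  classical
  induction s using Finset.induction_on with
  | empty => simpa using φ.act_zero_left x
  | insert a s ha ih => rw [Finset.sum_insert ha, Finset.sum_insert ha, act_add_left, ih]

/-- The action of matrices with entries in `A` on points. -/
noncomputable def matAct {m n : ℕ} (M : Matrix (Fin m) (Fin n) 𝔽[X]) (x : Fin n → E) : Fin m → E :=
  fun i => ∑ j, φ.act (M i j) (x j)

theorem matAct_mul {l m n : ℕ} (M : Matrix (Fin l) (Fin m) 𝔽[X])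
    (N : Matrix (Fin m) (Fin n) 𝔽[X]) (x : Fin n → E) :
    φ.matAct (M * N) x = φ.matAct M (φ.matAct N x) := by
  ext i
  simp only [matAct, Matrix.mul_apply, act_sum_left, act_sum_right, act_mul]
  exact Finset.sum_comm

theorem matAct_one {n : ℕ} (x : Fin n → E) :
    φ.matAct (1 : Matrix (Fin n) (Fin n) 𝔽[X]) x = x := by
  ext i
  rw [matAct, Finset.sum_eq_single i, Matrix.one_apply_eq, act_one]
  · intro j _ hj
    rw [Matrix.one_apply_ne hj.symm, act_zero_left]
  · intro h
    exact absurd (Finset.mem_univ i) h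

theorem matAct_add {m n : ℕ} (M : Matrix (Fin m) (Fin n) 𝔽[X]) (x y : Fin n → E) :
    φ.matAct M (x + y) = φ.matAct M x + φ.matAct M y := by
  ext i
  simp only [matAct, Pi.add_apply, act_add_right, Finset.sum_add_distrib]

theorem matAct_zero {m n : ℕ} (M : Matrix (Fin m) (Fin n) 𝔽[X]) :
    φ.matAct M (0 : Fin n → E) = 0 := by
  ext i
  simp [matAct, act_zero_right]

theorem diagAct_matAct {m n : ℕ} (M : Matrix (Fin m) (Fin n) 𝔽[X]) (a : 𝔽[X]) (x : Fin n → E) :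
    φ.diagAct a (φ.matAct M x) = φ.matAct M (φ.diagAct a x) := by
  ext i
  simp only [matAct, diagAct, act_sum_right, ← act_mul, mul_comm]

theorem isTorsionPoint_iff {g : ℕ} {x : Fin g → E} :
    φ.IsTorsionPoint x ↔ ∀ i, x i ∈ φ.torsion E := by
  constructor
  · rintro ⟨a, ha, h⟩ i
    exact ⟨a, ha, h i⟩
  · intro h
    choose a ha hax using h
    refine ⟨∏ i, a i, Finset.prod_ne_zero_iff.2 fun i _ => ha i, fun i => ?_⟩
    rw [← Finset.prod_erase_mul _ _ (Finset.mem_univ i), act_mul, hax, act_zero_right]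

theorem isTorsionPoint_add {g : ℕ} {x y : Fin g → E} (hx : φ.IsTorsionPoint x)
    (hy : φ.IsTorsionPoint y) : φ.IsTorsionPoint (x + y) := by
  rw [isTorsionPoint_iff] at hx hy ⊢
  exact fun i => add_mem (hx i) (hy i)

theorem isTorsionPoint_matAct {m n : ℕ} (M : Matrix (Fin m) (Fin n) 𝔽[X]) {x : Fin n → E}
    (hx : φ.IsTorsionPoint x) : φ.IsTorsionPoint (φ.matAct M x) := by
  obtain ⟨a, ha, h⟩ := hx
  refine ⟨a, ha, fun i => ?_⟩
  have h0 : φ.diagAct a x = 0 := funext h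
  have := congrFun (φ.diagAct_matAct M a x) i
  rw [h0, matAct_zero] at this
  exact this

end MatAct

section Geometry

variable (φ : DrinfeldModule 𝔽 K) {L : Type*} [Field L] [Algebra K L] {g n : ℕ}

theorem exists_algebraMap_eq_of_isTorsionPoint (hi : Function.Injective (algebraMap 𝔽[X] K))
    {x : Fin g → L} (hx : φ.IsTorsionPoint x) :
    ∃ y : Fin g → separableClosure K L, ∀ i, (y i : L) = x i := by
  obtain ⟨a, ha, h⟩ := hx
  exact ⟨fun i => ⟨x i, φ.mem_separableClosure_of_act_eq_zero L hi ha (h i)⟩, fun _ => rfl⟩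

theorem isSepMorphism_matAct {m : ℕ} (M : Matrix (Fin m) (Fin n) 𝔽[X]) :
    IsSepMorphism K (fun x : Fin n → L => φ.matAct M x) :=
  ⟨fun i => φ.linearForm _ (M i), fun x i => by rw [aeval_linearForm]; rfl⟩

theorem isSepMorphism_add_of_isTorsionPoint (hi : Function.Injective (algebraMap 𝔽[X] K))
    {α : Fin g → L} (hα : φ.IsTorsionPoint α) :
    IsSepMorphism K fun x : Fin g → L => α + x := by
  obtain ⟨c, hc⟩ := φ.exists_algebraMap_eq_of_isTorsionPoint hi hα
  refine ⟨fun i => MvPolynomial.C (c i) + MvPolynomial.X i, fun x i => ?_⟩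
  rw [map_add, MvPolynomial.aeval_X, MvPolynomial.aeval_C]
  exact congrArg (· + x i) (hc i).symm

theorem isSepIrreducible_of_isTorsionSubvariety (hi : Function.Injective (algebraMap 𝔽[X] K))
    {Z : Set (Fin g → L)} (hZ : φ.IsTorsionSubvariety Z) : IsSepIrreducible K Z := by
  obtain ⟨α, W, hα, hW, hirr, rfl⟩ := hZ
  exact (φ.isSepMorphism_add_of_isTorsionPoint hi hα).isSepIrreducible_image hirr.isSepIrreducible

theorem zero_mem_of_isAlgSubmodule {W : Set (Fin g → L)} (hW : φ.IsAlgSubmodule W)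
    (hne : W.Nonempty) : 0 ∈ W := by
  obtain ⟨w, hw⟩ := hne
  have := hW.2 0 w hw
  have h0 : φ.diagAct 0 w = 0 := funext fun i => φ.act_zero_left (w i)
  rwa [h0] at this

/-- A linear form that takes torsion values of bounded order on an irreducible set is constant. -/
theorem exists_forall_sum_act_eq (hi : Function.Injective (algebraMap 𝔽[X] K))
    {S : Set (Fin g → L)} (hS : IsSepIrreducible K S) {d : 𝔽[X]} (hd : d ≠ 0) (b : Fin g → 𝔽[X])
    (h : ∀ s ∈ S, φ.act d (∑ i, φ.act (b i) (s i)) = 0) :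
    ∃ c : separableClosure K L, φ.act d c = 0 ∧ ∀ s ∈ S, ∑ i, φ.act (b i) (s i) = c := by
  classical
  -- The form takes values among the finitely many roots of `φ_d`, so this product vanishes on `S`,
  -- and primality selects one factor.
  have hmem : ∏ c ∈ (φ.poly (separableClosure K L) d).roots.toFinset,
      (φ.linearForm (separableClosure K L) b - MvPolynomial.C c) ∈
        MvPolynomial.vanishingIdeal (separableClosure K L) S := fun s hs => by
    rw [map_prod]
    refine Finset.prod_eq_zero (i := ⟨_, φ.mem_separableClosure_of_act_eq_zero L hi hd (h s hs)⟩)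
      ?_ ?_
    · rw [Multiset.mem_toFinset, φ.mem_roots_poly _ hi hd]
      apply (algebraMap (separableClosure K L) L).injective
      rw [φ.algebraMap_act, map_zero]
      exact h s hs
    · rw [map_sub, aeval_linearForm, MvPolynomial.aeval_C, sub_eq_zero]
      rfl
  obtain ⟨c, hc, hcS⟩ := (Ideal.IsPrime.prod_mem_iff (hp := hS)).1 hmem
  refine ⟨c, (φ.mem_roots_poly _ hi hd).1 (Multiset.mem_toFinset.1 hc), fun s hs => ?_⟩
  have := hcS s hs
  rwa [map_sub, aeval_linearForm, MvPolynomial.aeval_C, sub_eq_zero] at this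

section Coordinates

variable {M M' : Matrix (Fin (n + 1)) (Fin (n + 1)) 𝔽[X]}

theorem matAct_cons_tail (hM' : M' * M = 1) (x : Fin (n + 1) → L) :
    φ.matAct M' (Fin.cons (φ.matAct M x 0) (Fin.tail (φ.matAct M x))) = x := by
  rw [Fin.cons_self_tail, ← matAct_mul, hM', matAct_one]

theorem isSepMorphism_matAct_cons (c : separableClosure K L) :
    IsSepMorphism K (fun y : Fin n → L => φ.matAct M' (Fin.cons (c : L) y)) :=
  IsSepMorphism.comp (φ.isSepMorphism_matAct M') (isSepMorphism_cons c)

theorem isSepMorphism_tail_matAct :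
    IsSepMorphism K (fun x : Fin (n + 1) → L => (Fin.tail (φ.matAct M x) : Fin n → L)) :=
  IsSepMorphism.comp isSepMorphism_tail (φ.isSepMorphism_matAct M)

/-- Rewriting the image as conditions on `M x` makes it visibly closed when `Z` is closed and `c`
lies in `K^sep`. -/
theorem image_matAct_cons (hM : M * M' = 1) (hM' : M' * M = 1) (c : L) (Z : Set (Fin n → L)) :
    (fun y : Fin n → L => φ.matAct M' (Fin.cons c y)) '' Z =
      {x | φ.matAct M x 0 = c} ∩ (fun x => Fin.tail (φ.matAct M x)) ⁻¹' Z := by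
  ext x
  constructor
  · rintro ⟨y, hy, rfl⟩
    simp only [Set.mem_inter_iff, Set.mem_ofPred_eq, Set.mem_preimage, ← matAct_mul, hM, matAct_one,
      Fin.cons_zero, Fin.tail_cons]
    exact ⟨trivial, hy⟩
  · rintro ⟨h0, hx⟩
    refine ⟨_, hx, ?_⟩
    have := φ.matAct_cons_tail hM' x
    rwa [show φ.matAct M x 0 = c from h0] at this

theorem isSepSubvariety_image_matAct_cons (hM : M * M' = 1) (hM' : M' * M = 1)
    (c : separableClosure K L) {Z : Set (Fin n → L)} (hZ : IsSepSubvariety K Z) :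
    IsSepSubvariety K ((fun y : Fin n → L => φ.matAct M' (Fin.cons (c : L) y)) '' Z) := by
  rw [φ.image_matAct_cons hM hM']
  refine IsSepSubvariety.inter ?_ (hZ.preimage φ.isSepMorphism_tail_matAct)
  convert isSepSubvariety_setOf_aeval_eq_zero
    (φ.linearForm (separableClosure K L) (M 0) - MvPolynomial.C c) using 3 with x
  rw [map_sub, aeval_linearForm, MvPolynomial.aeval_C, sub_eq_zero]
  rfl

theorem diagAct_cons (a : 𝔽[X]) (y : Fin n → L) :
    φ.diagAct a (Fin.cons 0 y : Fin (n + 1) → L) = Fin.cons 0 (φ.diagAct a y) := by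
  ext i
  refine Fin.cases ?_ (fun j => ?_) i
  · simp [diagAct, act_zero_right]
  · simp [diagAct]

theorem isTorsionPoint_cons {c : L} (hc : c ∈ φ.torsion L) {y : Fin n → L}
    (hy : φ.IsTorsionPoint y) : φ.IsTorsionPoint (Fin.cons c y : Fin (n + 1) → L) := by
  rw [isTorsionPoint_iff] at hy ⊢
  intro i
  refine Fin.cases ?_ (fun j => ?_) i
  · simpa using hc
  · simpa using hy j

/-- The splitting `(c, α + w) = (c, α) + (0, w)` separates the torsion translation from the
submodule, and the action of `M'` is additive and commutes with `A`. -/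
theorem isTorsionSubvariety_image_matAct_cons (hM : M * M' = 1) (hM' : M' * M = 1)
    {c : separableClosure K L} (hc : (c : L) ∈ φ.torsion L) {Z : Set (Fin n → L)}
    (hZ : φ.IsTorsionSubvariety Z) :
    φ.IsTorsionSubvariety ((fun y : Fin n → L => φ.matAct M' (Fin.cons (c : L) y)) '' Z) := by
  obtain ⟨α, W, hα, hW, hirr, rfl⟩ := hZ
  refine ⟨φ.matAct M' (Fin.cons (c : L) α), (fun y : Fin n → L => φ.matAct M' (Fin.cons 0 y)) '' W,
    φ.isTorsionPoint_matAct _ (φ.isTorsionPoint_cons hc hα), ⟨?_, ?_⟩, ?_, ?_⟩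
  · exact φ.isSepSubvariety_image_matAct_cons hM hM' 0 hW.1
  · rintro a _ ⟨w, hw, rfl⟩
    refine ⟨φ.diagAct a w, hW.2 a w hw, ?_⟩
    beta_reduce
    rw [diagAct_matAct, diagAct_cons]
  · refine (φ.isSepSubvariety_image_matAct_cons hM hM' 0 hW.1).isIrreducibleSepSubvariety ?_
    exact (φ.isSepMorphism_matAct_cons 0).isSepIrreducible_image hirr.isSepIrreducible
  · rw [Set.image_image, Set.image_image]
    refine Set.image_congr fun w _ => ?_
    rw [← matAct_add]
    congr 1
    ext i
    refine Fin.cases ?_ (fun j => ?_) i <;> simp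

end Coordinates

theorem isTorsionSubvariety_univ (hi : Function.Injective (algebraMap 𝔽[X] K)) :
    φ.IsTorsionSubvariety (Set.univ : Set (Fin g → L)) :=
  ⟨0, Set.univ, ⟨1, one_ne_zero, fun _ => φ.act_zero_right 1⟩,
    ⟨isSepSubvariety_univ, fun _ _ _ => Set.mem_univ _⟩,
    have := infinite_of_algebra 𝔽 K (separableClosure K L) hi
    isIrreducibleSepSubvariety_univ, by simp⟩

/-- Reduction of an irreducible set of torsion points on which a linear form vanishes to a set of
torsion points in a space of smaller dimension. -/
theorem isTorsionSubvariety_sepZariskiClosure_of_sum_act_eq_zero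
    (hi : Function.Injective (algebraMap 𝔽[X] K))
    (ih : ∀ S : Set (Fin n → L), (∀ x ∈ S, φ.IsTorsionPoint x) → IsSepIrreducible K S →
      φ.IsTorsionSubvariety (sepZariskiClosure K S))
    {S : Set (Fin (n + 1) → L)} (htors : ∀ x ∈ S, φ.IsTorsionPoint x) (hS : IsSepIrreducible K S)
    {b : Fin (n + 1) → 𝔽[X]} (hb : b ≠ 0) (hbS : ∀ s ∈ S, ∑ i, φ.act (b i) (s i) = 0) :
    φ.IsTorsionSubvariety (sepZariskiClosure K S) := by
  obtain ⟨M, M', d, hd, hM, hM', hbM⟩ := exists_unimodular_matrix b hb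
  -- As `b = d * M₀`, the first new coordinate of a point of `S` is killed by `φ_d`.
  obtain ⟨c, hdc, hc⟩ := φ.exists_forall_sum_act_eq hi hS hd (M 0) fun s hs => by
    rw [act_sum_right, ← hbS s hs]
    exact Finset.sum_congr rfl fun i _ => by rw [← act_mul, hbM]
  have hct : (c : L) ∈ φ.torsion L := by
    refine ⟨d, hd, ?_⟩
    have := congrArg (algebraMap (separableClosure K L) L) hdc
    rwa [φ.algebraMap_act, map_zero] at this
  have hback : ∀ s ∈ S, φ.matAct M' (Fin.cons (c : L) (Fin.tail (φ.matAct M s))) = s :=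
    fun s hs => by
      have := φ.matAct_cons_tail hM' s
      rwa [show φ.matAct M s 0 = c from hc s hs] at this
  set S' : Set (Fin n → L) := (fun x => Fin.tail (φ.matAct M x)) '' S with hS'
  have himage : (fun y : Fin n → L => φ.matAct M' (Fin.cons (c : L) y)) '' S' = S := by
    rw [hS', Set.image_image]
    exact (Set.image_congr fun s hs => hback s hs).trans (Set.image_id S)
  have hZ := ih S' (by
      rintro _ ⟨s, hs, rfl⟩
      have := φ.isTorsionPoint_iff.1 (φ.isTorsionPoint_matAct M (htors s hs))
      exact φ.isTorsionPoint_iff.2 fun i => this i.succ)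
    (φ.isSepMorphism_tail_matAct.isSepIrreducible_image hS)
  have heq : sepZariskiClosure K S =
      (fun y : Fin n → L => φ.matAct M' (Fin.cons (c : L) y)) '' sepZariskiClosure K S' := by
    refine Set.Subset.antisymm ?_ ?_
    · refine (φ.isSepSubvariety_image_matAct_cons hM hM' c
        (isSepSubvariety_sepZariskiClosure S')).sepZariskiClosure_subset ?_
      rw [← himage]
      exact Set.image_mono (subset_sepZariskiClosure S')
    · have := (φ.isSepMorphism_matAct_cons (M' := M') c).image_sepZariskiClosure_subset S'
      rwa [himage] at this
  rw [heq]
  exact φ.isTorsionSubvariety_image_matAct_cons hM hM' hct hZ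

variable [IsAlgClosed L]

instance isSepClosed_separableClosure : IsSepClosed (separableClosure K L) :=
  IsSepClosure.sep_closed K

/-- Torsion points are Zariski dense in affine space. -/
theorem eq_zero_of_forall_isTorsionPoint (hi : Function.Injective (algebraMap 𝔽[X] K))
    (f : MvPolynomial (Fin g) (separableClosure K L))
    (hf : ∀ x : Fin g → L, φ.IsTorsionPoint x → MvPolynomial.aeval x f = 0) : f = 0 := by
  refine MvPolynomial.funext_set (fun _ => (φ.torsion (separableClosure K L) : Set _))
    (fun _ => φ.infinite_torsion _ hi) fun x hx => ?_
  rw [map_zero]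
  apply (algebraMap (separableClosure K L) L).injective
  rw [map_zero, ← hf (fun i => (x i : L))]
  · rw [← MvPolynomial.aeval_eq_eval]
    exact (MvPolynomial.aeval_algebraMap_apply L x f).symm
  · rw [isTorsionPoint_iff]
    intro i
    obtain ⟨a, ha, h⟩ := hx i (Set.mem_univ i)
    refine ⟨a, ha, ?_⟩
    have := congrArg (algebraMap (separableClosure K L) L) h
    rwa [φ.algebraMap_act, map_zero] at this

/-- A proper irreducible algebraic submodule lies in the kernel of a linear form. -/
theorem exists_sum_act_eq_zero_of_isAlgSubmodule (hi : Function.Injective (algebraMap 𝔽[X] K))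
    (hEnd : φ.EndEqBase L) {W : Set (Fin g → L)} (hW : φ.IsAlgSubmodule W)
    (hirr : IsIrreducibleSepSubvariety K W) (hne : W ≠ Set.univ) :
    ∃ b : Fin g → 𝔽[X], b ≠ 0 ∧ ∀ w ∈ W, ∑ i, φ.act (b i) (w i) = 0 := by
  obtain ⟨b, hb, hmem⟩ := φ.exists_linearForm_mem hi (fun f hf hc => hEnd f hf hc)
    (MvPolynomial.vanishingIdeal (separableClosure K L) W) hirr.isSepIrreducible
    (fun h => hne (by
      rw [← hW.1.sepZariskiClosure_eq, sepZariskiClosure, h]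
      exact MvPolynomial.zeroLocus_bot))
    (fun f hf => by
      have h := hf 0 (φ.zero_mem_of_isAlgSubmodule hW hirr.2.1)
      apply (algebraMap (separableClosure K L) L).injective
      rw [map_zero, ← h, ← MvPolynomial.aeval_eq_eval]
      have := MvPolynomial.aeval_algebraMap_apply L (0 : Fin g → separableClosure K L) f
      rw [← this]
      congr 2)
    (fun a f hf w hw => by
      rw [aeval_pullback]
      exact hf _ (hW.2 a w hw))
  refine ⟨b, hb, fun w hw => ?_⟩
  have := hmem w hw
  rwa [aeval_linearForm] at this

/-- If `a` kills the translating point, multiplying by `a` the form that vanishes on the submodule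
absorbs the translation. -/
theorem exists_sum_act_eq_zero_of_isTorsionSubvariety
    (hi : Function.Injective (algebraMap 𝔽[X] K)) (hEnd : φ.EndEqBase L) {Z : Set (Fin g → L)}
    (hZ : φ.IsTorsionSubvariety Z) (hne : Z ≠ Set.univ) :
    ∃ b : Fin g → 𝔽[X], b ≠ 0 ∧ ∀ z ∈ Z, ∑ i, φ.act (b i) (z i) = 0 := by
  obtain ⟨α, W, ⟨a, ha, haα⟩, hW, hirr, rfl⟩ := hZ
  have hWne : W ≠ Set.univ := by
    rintro rfl
    apply hne
    rw [Set.image_univ]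
    exact (Equiv.addLeft α).surjective.range_eq
  obtain ⟨b, hb, h⟩ := φ.exists_sum_act_eq_zero_of_isAlgSubmodule hi hEnd hW hirr hWne
  refine ⟨a • b, smul_ne_zero ha hb, ?_⟩
  rintro _ ⟨w, hw, rfl⟩
  simp only [Pi.smul_apply, smul_eq_mul, Pi.add_apply, act_add_right, Finset.sum_add_distrib]
  have h1 : ∀ i, φ.act (a * b i) (α i) = 0 := fun i => by
    rw [mul_comm, act_mul, haα, act_zero_right]
  have h2 : ∑ i, φ.act (a * b i) (w i) = 0 := by
    simp only [act_mul]
    rw [← act_sum_right, h w hw, act_zero_right]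
  rw [h2, add_zero, Finset.sum_eq_zero fun i _ => h1 i]

/-- Torsion points are Zariski dense in irreducible algebraic submodules. -/
theorem subset_sepZariskiClosure_of_isAlgSubmodule (hi : Function.Injective (algebraMap 𝔽[X] K))
    (hEnd : φ.EndEqBase L) {W : Set (Fin g → L)} (hW : φ.IsAlgSubmodule W)
    (hirr : IsIrreducibleSepSubvariety K W) :
    W ⊆ sepZariskiClosure K {w | w ∈ W ∧ φ.IsTorsionPoint w} := by
  induction g with
  | zero =>
    intro w hw
    exact subset_sepZariskiClosure _ ⟨hw, φ.isTorsionPoint_iff.2 fun i => i.elim0⟩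
  | succ n ih =>
    by_cases hne : W = Set.univ
    · subst hne
      intro w _
      rw [mem_sepZariskiClosure]
      intro f hf
      rw [φ.eq_zero_of_forall_isTorsionPoint hi f fun x hx => hf x ⟨Set.mem_univ x, hx⟩, map_zero]
    obtain ⟨b, hb, hbW⟩ := φ.exists_sum_act_eq_zero_of_isAlgSubmodule hi hEnd hW hirr hne
    obtain ⟨M, M', d, hd, hM, hM', hbM⟩ := exists_unimodular_matrix b hb
    obtain ⟨c, -, hc⟩ := φ.exists_forall_sum_act_eq hi hirr.isSepIrreducible hd (M 0) fun w hw => by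
      rw [act_sum_right, ← hbW w hw]
      exact Finset.sum_congr rfl fun i _ => by rw [← act_mul, hbM]
    -- The constant value of the first coordinate is `0` because `0 ∈ W`.
    have hM0 : ∀ w ∈ W, φ.matAct M w 0 = 0 := fun w hw => by
      have h0 := hc 0 (φ.zero_mem_of_isAlgSubmodule hW hirr.2.1)
      rw [matAct, hc w hw, ← h0]
      simp [act_zero_right]
    have hback : ∀ w ∈ W, φ.matAct M' (Fin.cons 0 (Fin.tail (φ.matAct M w))) = w := fun w hw => by
      have := φ.matAct_cons_tail hM' w
      rwa [hM0 w hw] at this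
    set W' : Set (Fin n → L) := (fun x => Fin.tail (φ.matAct M x)) '' W with hW'
    have hpre : W' = (fun y : Fin n → L => φ.matAct M' (Fin.cons 0 y)) ⁻¹' W := by
      ext y
      constructor
      · rintro ⟨w, hw, rfl⟩
        rw [Set.mem_preimage, hback w hw]
        exact hw
      · intro hy
        refine ⟨_, hy, ?_⟩
        simp only [← matAct_mul, hM, matAct_one, Fin.tail_cons]
    have hclosed : IsSepSubvariety K W' := by
      rw [hpre]
      exact hW.1.preimage (φ.isSepMorphism_matAct_cons 0)
    have hsub := ih (W := W') ⟨hclosed, fun a y hy => by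
        rw [hpre] at hy ⊢
        have := hW.2 a _ hy
        rwa [diagAct_matAct, diagAct_cons] at this⟩
      (hclosed.isIrreducibleSepSubvariety
        (φ.isSepMorphism_tail_matAct.isSepIrreducible_image hirr.isSepIrreducible))
    intro w hw
    rw [← hback w hw]
    have h1 := (φ.isSepMorphism_matAct_cons (M' := M')
      (0 : separableClosure K L)).image_sepZariskiClosure_subset _
      ⟨_, hsub ⟨w, hw, rfl⟩, rfl⟩
    refine sepZariskiClosure_mono ?_ h1
    rintro _ ⟨y, ⟨hy, hyt⟩, rfl⟩
    rw [hpre] at hy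
    exact ⟨hy, φ.isTorsionPoint_matAct _ (φ.isTorsionPoint_cons (zero_mem _) hyt)⟩

theorem subset_sepZariskiClosure_of_isTorsionSubvariety
    (hi : Function.Injective (algebraMap 𝔽[X] K))
    (hEnd : φ.EndEqBase L) {Z : Set (Fin g → L)} (hZ : φ.IsTorsionSubvariety Z) :
    Z ⊆ sepZariskiClosure K {z | z ∈ Z ∧ φ.IsTorsionPoint z} := by
  obtain ⟨α, W, hα, hW, hirr, rfl⟩ := hZ
  rintro _ ⟨w, hw, rfl⟩
  have h1 := (φ.isSepMorphism_add_of_isTorsionPoint hi hα).image_sepZariskiClosure_subset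
    _ ⟨_, φ.subset_sepZariskiClosure_of_isAlgSubmodule hi hEnd hW hirr hw, rfl⟩
  refine sepZariskiClosure_mono ?_ h1
  rintro _ ⟨y, ⟨hy, hyt⟩, rfl⟩
  exact ⟨⟨y, hy, rfl⟩, φ.isTorsionPoint_add hα hyt⟩

end Geometry

end DrinfeldModule

-- Strict sequences, Galois orbits and equidistribution

attribute [local instance] MvPolynomial.algebraMvPolynomial in
-- `E[x]` is integral over `K[x]`, so nonzero ideals contract to nonzero ideals. This descent is
-- needed because only polynomials over `K` pass from a point to its Galois conjugates.
theorem MvPolynomial.exists_map_mem_of_mem {K E : Type*} [Field K] [Field E] [Algebra K E]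
    [Algebra.IsIntegral K E] {σ : Type*} {I : Ideal (MvPolynomial σ E)} {f : MvPolynomial σ E}
    (hf : f ∈ I) (hf0 : f ≠ 0) :
    ∃ F : MvPolynomial σ K, F ≠ 0 ∧ MvPolynomial.map (algebraMap K E) F ∈ I := by
  have hint : IsIntegral (MvPolynomial σ K) f :=
    MvPolynomial.isIntegral_iff_isIntegral_coeff.2 fun _ => Algebra.IsIntegral.isIntegral _
  obtain ⟨F, hF, hF0⟩ := Submodule.exists_mem_ne_zero_of_ne_bot
    (Ideal.comap_ne_bot_of_integral_mem hf0 hf hint)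
  exact ⟨F, hF0, hF⟩

theorem Polynomial.countable_of_finite (F : Type*) [Semiring F] [Finite F] : Countable F[X] := by
  rw [← Cardinal.mk_le_aleph0_iff]
  exact Polynomial.cardinalMk_le_max.trans (max_le (Cardinal.mk_le_aleph0_iff.2 inferInstance)
    le_rfl)

namespace DrinfeldModule

variable {𝔽 K L : Type*} [Field 𝔽] [Fintype 𝔽] [Field K] [Algebra 𝔽[X] K]

/-- An irreducible set of torsion points that lies in no kernel of a linear form contains a strict
sequence. -/
theorem exists_isStrict_sequence [Field L] [Algebra K L] [IsAlgClosed L] (φ : DrinfeldModule 𝔽 K)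
    (hi : Function.Injective (algebraMap 𝔽[X] K)) (hEnd : φ.EndEqBase L) {g : ℕ}
    {S : Set (Fin g → L)} (hS : IsSepIrreducible K S)
    (hb : ∀ b : Fin g → 𝔽[X], b ≠ 0 → ∃ s ∈ S, ∑ i, φ.act (b i) (s i) ≠ 0) :
    ∃ x : ℕ → Fin g → L, (∀ k, x k ∈ S) ∧ φ.IsStrict x := by
  classical
  have := Polynomial.countable_of_finite 𝔽
  obtain ⟨e, he⟩ := exists_surjective_nat (Fin g → 𝔽[X])
  -- Since `A ^ g` is countable, the forms can be enumerated. By irreducibility `S` is not covered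
  -- by the kernels of the nonzero forms among the first `k`.
  have key : ∀ k : ℕ, ∃ s ∈ S, ∀ m < k, e m ≠ 0 → ∑ i, φ.act (e m i) (s i) ≠ 0 := fun k => by
    by_contra! hcon
    obtain ⟨m, hm, hsub⟩ := hS.exists_subset ((Finset.range k).filter fun m => e m ≠ 0)
      (fun m => {x | MvPolynomial.aeval x (φ.linearForm (separableClosure K L) (e m)) = 0})
      (fun m => isSepSubvariety_setOf_aeval_eq_zero _) (fun s hs => by
        obtain ⟨m, hm, hem, h⟩ := hcon s hs
        refine Set.mem_iUnion₂.2 ⟨m, Finset.mem_filter.2 ⟨Finset.mem_range.2 hm, hem⟩, ?_⟩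
        rw [Set.mem_ofPred_eq, aeval_linearForm, h])
    obtain ⟨s, hs, hne⟩ := hb (e m) (Finset.mem_filter.1 hm).2
    apply hne
    have := hsub hs
    rwa [Set.mem_ofPred_eq, aeval_linearForm] at this
  choose x hxS hx using key
  refine ⟨x, hxS, fun Z hZ hne => ?_⟩
  obtain ⟨b, hb0, hbZ⟩ := φ.exists_sum_act_eq_zero_of_isTorsionSubvariety hi hEnd hZ hne
  obtain ⟨m, rfl⟩ := he b
  -- A proper torsion subvariety lies in the kernel of form number `m`, which every `x k` with `k >
  -- m` avoids.
  refine (Set.finite_le_nat m).subset fun k hk => ?_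
  by_contra hmk
  exact hx k m (not_le.1 hmk) hb0 (hbZ _ hk)

section Analytic

variable [NormedField L] [Algebra K L]

/-- A polynomial over `K` that vanishes at `x` vanishes on the Galois orbit of `x`. -/
theorem aeval_eq_zero_of_mem_galoisOrbit (φ : DrinfeldModule 𝔽 K) {g : ℕ}
    {x : Fin g → separableClosure K L} {F : MvPolynomial (Fin g) K}
    (hF : MvPolynomial.aeval (fun i => (x i : L)) F = 0) {y : Fin g → φ.torsionClosure L}
    (hy : y ∈ φ.galoisOrbit x) : MvPolynomial.aeval (fun i => (y i : L)) F = 0 := by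
  obtain ⟨σ, hσ⟩ := hy
  have h0 : MvPolynomial.aeval x F = 0 := by
    apply (algebraMap (separableClosure K L) L).injective
    rw [map_zero, ← hF]
    exact (MvPolynomial.aeval_algebraMap_apply L x F).symm
  have h1 : MvPolynomial.aeval (fun i => σ (x i)) F = 0 := by
    rw [← map_zero σ, ← h0]
    exact (DFunLike.congr_fun (MvPolynomial.comp_aeval x σ.toAlgHom) F).symm
  have h2 := congrArg (algebraMap (separableClosure K L) L) h1
  rw [map_zero, ← MvPolynomial.aeval_algebraMap_apply] at h2
  rw [← h2]
  congr 2
  ext i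
  exact hσ i

theorem orbitMeasure_eq_zero [MeasurableSpace L] (φ : DrinfeldModule 𝔽 K) {g : ℕ}
    (x : Fin g → separableClosure K L)
    {U : Set (Fin g → φ.torsionClosure L)} (hU : MeasurableSet U)
    (h : ∀ y ∈ φ.galoisOrbit x, y ∉ U) : φ.orbitMeasure x U = 0 := by
  rw [orbitMeasure, Measure.smul_apply]
  have : (∑ᶠ y ∈ φ.galoisOrbit x, Measure.dirac y) U = 0 := by
    -- This induction also covers the default value `0` of the sum, so finiteness of the orbit is
    -- not needed.
    refine finsum_mem_induction (fun μ : Measure (Fin g → φ.torsionClosure L) => μ U = 0) ?_ ?_ ?_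
    · simp
    · intro μ₁ μ₂ h₁ h₂
      rw [Measure.add_apply, h₁, h₂, add_zero]
    · intro y hy
      rw [Measure.dirac_apply' _ hU, Set.indicator_of_notMem (h y hy)]
  rw [this, smul_zero]

variable [ExtendsDegreeNorm 𝔽 K L] [IsUltrametricDist L] [CompleteSpace L] [IsAlgClosed L]
  [MeasurableSpace L] [BorelSpace L]

instance isOpenPosMeasure_haarProbPi (φ : DrinfeldModule 𝔽 K) (g : ℕ) :
    (φ.haarProbPi L g).IsOpenPosMeasure := by
  have : (φ.haarProb L).IsOpenPosMeasure := by
    unfold haarProb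
    infer_instance
  unfold haarProbPi
  infer_instance

instance isProbabilityMeasure_haarProbPi (φ : DrinfeldModule 𝔽 K) (g : ℕ) :
    IsProbabilityMeasure (φ.haarProbPi L g) := by
  unfold haarProbPi
  infer_instance

/-- A polynomial over `K` that vanishes on an equidistributed sequence vanishes on `T ^ g`. -/
theorem aeval_eq_zero_of_weaklyConverges (φ : DrinfeldModule 𝔽 K) {g : ℕ}
    {x : ℕ → Fin g → separableClosure K L} {F : MvPolynomial (Fin g) K}
    (hF : ∀ k, MvPolynomial.aeval (fun i => (x k i : L)) F = 0)
    (hconv : WeaklyConverges (fun k => φ.orbitMeasure (x k)) (φ.haarProbPi L g))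
    (y : Fin g → φ.torsionClosure L) : MvPolynomial.aeval (fun i => (y i : L)) F = 0 := by
  by_contra hy
  have hcont : Continuous fun y : Fin g → φ.torsionClosure L =>
      min ‖MvPolynomial.aeval (fun i => (y i : L)) F‖ 1 := by
    refine (Continuous.norm ?_).min continuous_const
    have h1 := MvPolynomial.continuous_eval (MvPolynomial.map (algebraMap K L) F)
    have h2 : Continuous fun y : Fin g → φ.torsionClosure L => fun i => (y i : L) := by fun_prop
    convert! h1.comp h2 using 2 with y
    rw [Function.comp_apply, MvPolynomial.eval_map, MvPolynomial.aeval_def]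
  let ψ : (Fin g → φ.torsionClosure L) →ᵇ ℝ :=
    BoundedContinuousFunction.ofNormedAddCommGroup _ hcont 1 fun y => by
      rw [Real.norm_of_nonneg (by positivity)]
      exact min_le_right _ _
  have hψ : ∀ y, ψ y = min ‖MvPolynomial.aeval (fun i => (y i : L)) F‖ 1 := fun y => rfl
  have hzero : ∀ k, ∫ s, ψ s ∂(φ.orbitMeasure (x k)) = 0 := fun k => by
    refine integral_eq_zero_of_ae ?_
    rw [Filter.EventuallyEq, ae_iff]
    refine φ.orbitMeasure_eq_zero (x k) ?_ fun y hy => ?_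
    · exact (isOpen_ne_fun ψ.continuous continuous_const).measurableSet
    · rw [Set.mem_ofPred_eq, not_not, hψ, φ.aeval_eq_zero_of_mem_galoisOrbit (hF k) hy]
      simp
  have hlim := hconv ψ
  simp only [hzero] at hlim
  have h0 := tendsto_nhds_unique hlim tendsto_const_nhds
  -- Haar measure charges every nonempty open set, so a nonnegative continuous function that is
  -- nonzero at `y` has positive integral. The orbit integrals are all zero, hence so is their
  -- limit.
  have hpos : 0 < ∫ s, ψ s ∂(φ.haarProbPi L g) := by
    refine ψ.continuous.integral_pos_of_hasCompactSupport_nonneg_nonzero (x := y)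
      (HasCompactSupport.of_compactSpace _) (fun s => ?_) ?_
    · rw [hψ]
      exact le_min (norm_nonneg _) zero_le_one
    · rw [hψ]
      exact (lt_min (norm_pos_iff.2 hy) one_pos).ne'
  exact hpos.ne' h0

/-- Under the equidistribution conjecture, an irreducible set of torsion points that lies in no
kernel of a linear form is Zariski dense. -/
theorem sepZariskiClosure_eq_univ (φ : DrinfeldModule 𝔽 K) (hEnd : φ.EndEqBase L) {g : ℕ}
    (hconj : φ.EquidistributionConjecture L g) {S : Set (Fin g → L)}
    (htors : ∀ x ∈ S, φ.IsTorsionPoint x) (hS : IsSepIrreducible K S)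
    (hb : ∀ b : Fin g → 𝔽[X], b ≠ 0 → ∃ s ∈ S, ∑ i, φ.act (b i) (s i) ≠ 0) :
    sepZariskiClosure K S = Set.univ := by
  have hi := algebraMap_base_injective 𝔽 K L
  obtain ⟨x, hxS, hx⟩ := φ.exists_isStrict_sequence hi hEnd hS hb
  choose y hy using fun k => φ.exists_algebraMap_eq_of_isTorsionPoint hi (htors _ (hxS k))
  have hyx : (fun k i => (y k i : L)) = x := funext fun k => funext fun i => hy k i
  have hconv := hconj hEnd y (fun k => by
    rw [show (fun i => (y k i : L)) = x k from congrFun hyx k]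
    exact htors _ (hxS k)) (by rwa [hyx])
  have hI : MvPolynomial.vanishingIdeal (separableClosure K L) S = ⊥ := by
    rw [eq_bot_iff]
    intro f hf
    by_contra hf0
    obtain ⟨F, hF0, hF⟩ := MvPolynomial.exists_map_mem_of_mem (K := K) hf hf0
    have hFS : ∀ s ∈ S, MvPolynomial.aeval s F = 0 := fun s hs => by
      have := hF s hs
      rwa [MvPolynomial.aeval_map_algebraMap] at this
    have hFT := φ.aeval_eq_zero_of_weaklyConverges (F := F) (fun k => by
      rw [show (fun i => (y k i : L)) = x k from congrFun hyx k]
      exact hFS _ (hxS k)) hconv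
    -- `T ^ g` contains all torsion points, and these are Zariski dense in affine space.
    have hmap := φ.eq_zero_of_forall_isTorsionPoint hi
      (MvPolynomial.map (algebraMap K (separableClosure K L)) F) fun z hz => by
        rw [MvPolynomial.aeval_map_algebraMap]
        exact hFT fun i => ⟨z i, subset_closure (φ.isTorsionPoint_iff.1 hz i)⟩
    apply hF0
    refine MvPolynomial.map_injective _ (algebraMap K (separableClosure K L)).injective ?_
    rw [hmap, map_zero]
  rw [sepZariskiClosure, hI]
  exact MvPolynomial.zeroLocus_bot

/-- The closure of an irreducible set of torsion points is a torsion subvariety. -/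
theorem isTorsionSubvariety_sepZariskiClosure (φ : DrinfeldModule 𝔽 K) (hEnd : φ.EndEqBase L) :
    ∀ g : ℕ, (∀ h, 1 ≤ h → h ≤ g → φ.EquidistributionConjecture L h) → ∀ S : Set (Fin g → L),
      (∀ x ∈ S, φ.IsTorsionPoint x) → IsSepIrreducible K S →
      φ.IsTorsionSubvariety (sepZariskiClosure K S) := by
  intro g
  have hi := algebraMap_base_injective 𝔽 K L
  induction g with
  | zero =>
    intro _ S _ hS
    -- Affine space of dimension `0` is a point, so no equidistribution is needed to start the
    -- induction.
    have : sepZariskiClosure K S = Set.univ :=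
      Set.eq_univ_of_forall fun x => subset_sepZariskiClosure S (by
        obtain ⟨s, hs⟩ := hS.nonempty
        rwa [Subsingleton.elim x s])
    rw [this]
    exact φ.isTorsionSubvariety_univ hi
  | succ n ih =>
    intro hconj S htors hS
    by_cases hb : ∀ b : Fin (n + 1) → 𝔽[X], b ≠ 0 → ∃ s ∈ S, ∑ i, φ.act (b i) (s i) ≠ 0
    · rw [φ.sepZariskiClosure_eq_univ hEnd (hconj _ (by omega) le_rfl) htors hS hb]
      exact φ.isTorsionSubvariety_univ hi
    · push Not at hb
      obtain ⟨b, hb0, hbS⟩ := hb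
      exact φ.isTorsionSubvariety_sepZariskiClosure_of_sum_act_eq_zero hi
        (ih fun h h1 h2 => hconj h h1 (by omega)) htors hS hb0 hbS

end Analytic

end DrinfeldModule

/-! ### Finiteness of the maximal torsion subvarieties -/

theorem mainTheorem2 {𝔽 K L : Type*} [Field 𝔽] [Fintype 𝔽] [Field K] [Algebra (Polynomial 𝔽) K]
    [NormedField L] [IsUltrametricDist L] [CompleteSpace L] [IsAlgClosed L]
    [MeasurableSpace L] [BorelSpace L] [Algebra K L] [ExtendsDegreeNorm 𝔽 K L]
    (φ : DrinfeldModule 𝔽 K) (hEnd : φ.EndEqBase L) (N : ℕ)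
    (hconj : ∀ g : ℕ, 1 ≤ g → g ≤ N → φ.EquidistributionConjecture L g)
    (Y : Set (Fin N → L)) (hY : φ.IsAlgSubmodule Y)
    (X : Set (Fin N → L)) (hX : IsSepSubvariety K X) (hXY : X ⊆ Y) :
    {Z : Set (Fin N → L) | φ.IsMaximalTorsionSubvariety X Z}.Finite := by
  have hi := DrinfeldModule.algebraMap_base_injective 𝔽 K L
  obtain ⟨s, hsfin, hsirr, hs⟩ := exists_finset_isSepIrreducible (K := K)
    {x : Fin N → L | x ∈ X ∧ φ.IsTorsionPoint x}
  have hsub : ∀ T ∈ s, T ⊆ {x : Fin N → L | x ∈ X ∧ φ.IsTorsionPoint x} := fun T hT => by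
    rw [hs]
    exact Set.subset_sUnion_of_mem hT
  refine (hsfin.image fun T => sepZariskiClosure K T).subset fun Z hZ => ?_
  obtain ⟨⟨hZtors, hZX⟩, hmax⟩ := hZ
  have hdense := φ.subset_sepZariskiClosure_of_isTorsionSubvariety hi hEnd hZtors
  have hirr := (φ.isSepIrreducible_of_isTorsionSubvariety hi hZtors).of_subset_sepZariskiClosure
    (fun z hz => hz.1) hdense
  -- The torsion points of `Z` form an irreducible set covered by the closures of the finitely many
  -- pieces `T`, so they lie in one of these closures.
  obtain ⟨T, hT, hDT⟩ := hirr.exists_subset hsfin.toFinset (fun T => sepZariskiClosure K T)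
    (fun T => isSepSubvariety_sepZariskiClosure T) fun z hz => by
      obtain ⟨T, hT, hzT⟩ : z ∈ ⋃₀ s := hs.subset ⟨hZX hz.1, hz.2⟩
      exact Set.mem_iUnion₂.2 ⟨T, hsfin.mem_toFinset.2 hT, subset_sepZariskiClosure T hzT⟩
  have hZT := hdense.trans ((isSepSubvariety_sepZariskiClosure T).sepZariskiClosure_subset hDT)
  rw [Set.Finite.mem_toFinset] at hT
  refine ⟨T, hT, ?_⟩
  have hTtors := φ.isTorsionSubvariety_sepZariskiClosure hEnd N hconj T
    (fun x hx => (hsub T hT hx).2) (hsirr T hT)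
  have hTX : sepZariskiClosure K T ⊆ X :=
    hX.sepZariskiClosure_subset fun x hx => (hsub T hT hx).1
  -- The closure of `T` is itself a torsion subvariety of `X` containing `Z`, so maximality gives
  -- equality.
  exact (hmax ⟨hTtors, hTX⟩ hZT).antisymm hZT
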